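/- For a field extension $L/K$ and a $K$-scheme $X$, let $X(L)$ be the set of $K$-morphisms $\operatorname{Spec} L\to X$. A projective variety over $K$ is an integral projective scheme over $K$. A closed subscheme $Y\subset X$ is $f$-invariant, for $f\colon X\to X$, if $f|_Y$ factors through $Y$; $f^{-n}(Y)$ denotes the scheme-theoretic inverse image of $Y$ under the $n$-th iterate $f^n$. The following two assertions are equivalent. (1) For every number field $K$, every projective variety $X$ over $K$, every surjective morphism $f\colon X\to X$ over $K$, and every $f$-invariant closed subscheme $Y\subset X$, there is $s_0\in\mathbb{Z}_{\ge 0}$ such that for all $s\ge s_0$, $$\bigl(f^{-s-1}(Y)\smallsetminus f^{-s}(Y)\bigr)(K)=\emptyset .$$ (2) For every number field $K$, every projective variety $X$ over $K$, every surjective morphism $f\colon X\to X$ over $K$, every $f$-invariant closed subscheme $Y\subset X$, and every $d\in\mathbb{Z}_{\ge 0}$, there is $s_0\in\mathbb{Z}_{\ge 0}$ such that for all $s\ge s_0$, $$\bigl(f^{-s-1}(Y)\smallsetminus f^{-s}(Y)\bigr)(L)=\emptyset$$ for all field extensions $L/K$ with $[L:K]\le d$. -/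

import Mathlib

open CategoryTheory AlgebraicGeometry

universe u

namespace PreimagesQ

noncomputable section

attribute [local instance] MvPolynomial.gradedAlgebra

/-- Projective `n`-space over a field `K`, as a scheme over `Spec K`:
`Proj K[x₀, …, xₙ]` with the standard grading. -/
def projSpace (K : Type u) [Field K] (n : ℕ) : Over (Spec (CommRingCat.of K)) :=
  Over.mk
    (Proj.toSpecZero (MvPolynomial.homogeneousSubmodule (Fin (n + 1)) K) ≫
      Spec.map (CommRingCat.ofHom
        (algebraMap K (MvPolynomial.homogeneousSubmodule (Fin (n + 1)) K 0))))

variable {K : Type u} [Field K]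

/-- A projective variety over `K`: an integral `K`-scheme that is a closed subscheme of some
projective space over `K`. -/
structure IsProjectiveVariety (X : Over (Spec (CommRingCat.of K))) : Prop where
  integral : IsIntegral X.left
  projective : ∃ (n : ℕ) (j : X ⟶ projSpace K n), IsClosedImmersion j.left

/-- The set `X(L)` of `L`-rational points of a `K`-scheme `X`: morphisms `Spec L ⟶ X` over `K`. -/
abbrev Points (X : Over (Spec (CommRingCat.of K))) (L : Type u) [Field L] [Algebra K L] : Type u :=
  Over.mk (Spec.map (CommRingCat.ofHom (algebraMap K L))) ⟶ X

/-- The set `Y(L)`, for a closed subscheme `Y` of `X` (given by its ideal sheaf), as a subset of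
`X(L)`: the `L`-points of `X` that factor through `Y`. -/
def pointsOf {X : Over (Spec (CommRingCat.of K))} (Y : X.left.IdealSheafData)
    (L : Type u) [Field L] [Algebra K L] : Set (Points X L) :=
  {x | ∃ y : Spec (CommRingCat.of L) ⟶ Y.subscheme, y ≫ Y.subschemeι = x.left}

/-- `Y` is `f`-invariant: the restriction of `f` to `Y` factors through `Y`. -/
def IsInvariant {X : Over (Spec (CommRingCat.of K))} (f : X ⟶ X)
    (Y : X.left.IdealSheafData) : Prop :=
  ∃ g : Y.subscheme ⟶ Y.subscheme, g ≫ Y.subschemeι = Y.subschemeι ≫ f.left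

/-- The `n`-th iterate of a self-morphism. -/
def iter {X : Over (Spec (CommRingCat.of K))} (f : X ⟶ X) : ℕ → (X ⟶ X)
  | 0 => 𝟙 X
  | n + 1 => iter f n ≫ f

/-- The closed subscheme `f⁻ⁿ(Y)`: the scheme-theoretic inverse image of `Y` under `fⁿ`. -/
abbrev preimage {X : Over (Spec (CommRingCat.of K))} (f : X ⟶ X) (Y : X.left.IdealSheafData)
    (n : ℕ) : X.left.IdealSheafData :=
  Y.comap (iter f n).left

/-- The set `(f⁻ˢ⁻¹(Y) ∖ f⁻ˢ(Y))(L)`. -/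
def newPoints {X : Over (Spec (CommRingCat.of K))} (f : X ⟶ X) (Y : X.left.IdealSheafData)
    (s : ℕ) (L : Type u) [Field L] [Algebra K L] : Set (Points X L) :=
  pointsOf (preimage f Y (s + 1)) L \ pointsOf (preimage f Y s) L

/-- The Preimages Question for `(K, X, f, Y)` has a positive answer. -/
def PIQ (K : Type u) [Field K] (X : Over (Spec (CommRingCat.of K))) (f : X ⟶ X)
    (Y : X.left.IdealSheafData) : Prop :=
  ∃ s₀ : ℕ, ∀ s : ℕ, s₀ ≤ s → newPoints f Y s K = ∅

/-- The Preimages Question for `(K, X, f, Y, d)`, with a bound that is uniform in all extensions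
`L/K` of degree at most `d`, has a positive answer. -/
def PIQBoundedDegree (K : Type u) [Field K] (X : Over (Spec (CommRingCat.of K))) (f : X ⟶ X)
    (Y : X.left.IdealSheafData) (d : ℕ) : Prop :=
  ∃ s₀ : ℕ, ∀ s : ℕ, s₀ ≤ s →
    ∀ (L : Type u) [Field L] [Algebra K L],
      FiniteDimensional K L → Module.finrank K L ≤ d → newPoints f Y s L = ∅

end

end PreimagesQ

/-!
# Preimages of invariant subschemes: from rational points to points of bounded degree

A point `x` of `X` over an extension `L/K` of degree `d` has `d` conjugates over an algebraic
closure of `K`. Together they form a geometric point of `X ^ d` that the Galois group moves by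
permutations of the coordinates only, so its image in the symmetric product `Z = X ^ d / S_d` is a
`K`-point. The self-map `f` induces a self-map `g` of `Z`, the closed subset `Y ^ d` has a closed
`g`-stable image `T` in `Z` whose inverse image is `Y ^ d`, and the `n`-th iterate of `f` maps `x`
into `Y` if and only if the `n`-th iterate of `g` maps the `K`-point into `T`. So the assertion for
points of degree `d` on `X` is the assertion for rational points on `Z`
(`exists_bound_of_finrank_eq`). Degrees `1, …, d` are treated one at a time.

The assertion for rational points is about integral schemes, and `Z` need not be integral, as `X`
need not be geometrically integral. The induced map `g` is surjective, because its lift to `X ^ d`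
is (`surjective_of_comp_pr_eq_ite`), so some iterate of `g` maps every irreducible component of `Z`
onto itself. Therefore the assertion for the components with their reduced structures gives the one
for `Z` (`boundedEntry_of_projective`). Only the supports of the closed subschemes matter, because a
field-valued point factors through a closed subscheme if and only if its image lies in the support.

The symmetric product is constructed as the scheme-theoretic image of a morphism from `X ^ d` to a
projective space. There are `m + 1` linear forms `l_0, …, l_m`, with `m` large, such that any `d`
points of `X` lie in one common affine open set `l_t ≠ 0` (`nonempty_generalCharts`). The morphism
is given by the coefficients of the product over the `d` factors of `∑ l_s T_s`, up to constants
(`GeneralCharts.projCharts`). It is invariant under permutations. On the chart of `X ^ d` given by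
`l_t`, the invariant functions are generated by symmetrised monomials, and in characteristic zero
these are polynomials in the symmetrised products of at most `d` coordinate functions
(`mem_adjoin_permSum`), which come from projective space. Hence the morphism to its image is a
quotient by the symmetric group (`exists_symmetricProduct`, `isOrbitQuotient_of_cover`), and
invariant morphisms descend along it (`IsOrbitQuotient.exists_desc`).
-/

attribute [local instance] MvPolynomial.gradedAlgebra

/-! ### Symmetric functions of several sets of variables -/

section Multisymmetric

open Finset

/-- If enough values of a polynomial function with coefficients in a module lie in a subspace,
then so do its coefficients. -/
lemma mem_of_forall_mem_sum_pow_smul_mem {K M : Type*} [Field K] [AddCommGroup M]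
    [Module K M] (S : Submodule K M) (N : ℕ) (f : ℕ → M) (s : Finset K) (hs : N ≤ s.card)
    (h : ∀ c ∈ s, ∑ i ∈ range N, c ^ i • f i ∈ S) {i : ℕ} (hi : i < N) : f i ∈ S := by
  rw [← Submodule.Quotient.mk_eq_zero, ← Module.forall_dual_apply_eq_zero_iff K]
  intro φ
  let q : Polynomial K := ∑ j ∈ range N, Polynomial.monomial j (φ (Submodule.Quotient.mk (f j)))
  have hq : q = 0 := by
    refine Polynomial.eq_zero_of_degree_lt_of_eval_finset_eq_zero s ?_ fun c hc ↦ ?_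
    · refine lt_of_lt_of_le ?_ (Nat.cast_le.2 hs)
      refine (Polynomial.degree_sum_le _ _).trans_lt ?_
      exact (Finset.sup_lt_iff (WithBot.bot_lt_coe N)).2 fun j hj ↦
        (Polynomial.degree_monomial_le _ _).trans_lt (Nat.cast_lt.2 (mem_range.1 hj))
    · have := congrArg φ ((Submodule.Quotient.mk_eq_zero S).2 (h c hc))
      rw [← Submodule.mkQ_apply, map_sum, map_sum] at this
      simpa [q, Polynomial.eval_finsetSum, mul_comm] using this
  have := congrArg (fun r ↦ Polynomial.coeff r i) hq
  simpa [q, Polynomial.finsetSum_coeff, Polynomial.coeff_monomial, hi] using this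

lemma mem_of_forall_sum_pow_smul_mem {K M : Type*} [Field K] [Infinite K] [AddCommGroup M]
    [Module K M] (S : Submodule K M) (N : ℕ) (f : ℕ → M)
    (h : ∀ c : K, ∑ i ∈ range N, c ^ i • f i ∈ S) {i : ℕ} (hi : i < N) : f i ∈ S := by
  obtain ⟨s, hs⟩ := Infinite.exists_subset_card_eq K N
  exact mem_of_forall_mem_sum_pow_smul_mem S N f s hs.ge (fun c _ ↦ h c) hi

variable {K B R : Type*} [Field K] [CharZero K] [CommRing B] [CommRing R] [Algebra K B]
  [Algebra K R] {d : ℕ} (p : Fin d → B →ₐ[K] R) (S : Subalgebra K R)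

/-- The sum of the `d` conjugates of an element, its conjugates being its images under `p`. -/
def conjSum : B →ₗ[K] R := ∑ k, (p k).toLinearMap

omit [CharZero K] in
lemma conjSum_apply (b : B) : conjSum p b = ∑ k, p k b := by
  simp [conjSum]

/-- Newton's identities: power sums of conjugates are polynomials in the elementary symmetric
functions, and the latter are the coefficients of `c ↦ ∏ (c + p k v)`. -/
lemma conjSum_pow_mem (v : B) (hv : ∀ c : K, ∏ k, p k (v + algebraMap K B c) ∈ S) (e : ℕ) :
    conjSum p (v ^ e) ∈ S := by
  have hes : ∀ j ≤ d, MvPolynomial.aeval (fun k ↦ p k v) (MvPolynomial.esymm (Fin d) K j) ∈ S := by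
    intro j hj
    have := mem_of_forall_sum_pow_smul_mem (K := K) (Subalgebra.toSubmodule S) (d + 1)
      (fun i ↦ MvPolynomial.aeval (fun k ↦ p k v) (MvPolynomial.esymm (Fin d) K (d - i))) ?_
      (i := d - j) (by omega)
    · simpa [Nat.sub_sub_self hj] using this
    · intro c
      have h1 := congrArg (fun q ↦ MvPolynomial.aeval (fun k ↦ p k v)
        (Polynomial.eval (MvPolynomial.C c) q)) (MvPolynomial.prod_C_add_X_eq_sum_esymm K (Fin d))
      simp only [Polynomial.eval_prod, Polynomial.eval_finsetSum, Polynomial.eval_add,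
        Polynomial.eval_X, Polynomial.eval_C, map_prod, map_add, MvPolynomial.aeval_X,
        MvPolynomial.algHom_C, Polynomial.eval_mul, Polynomial.eval_pow, map_sum, map_mul,
        map_pow, Fintype.card_fin] at h1
      have h2 := hv c
      simp only [map_add, AlgHom.commutes] at h2
      rw [Subalgebra.mem_toSubmodule]
      convert h2 using 1
      rw [← sum_range_reflect, sum_congr rfl fun k _ ↦ rfl]
      refine Eq.trans ?_ (h1.symm.trans (prod_congr rfl fun k _ ↦ add_comm _ _))
      refine sum_congr rfl fun k hk ↦ ?_
      have : k ≤ d := by simpa [Nat.lt_succ_iff] using hk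
      rw [Algebra.smul_def, mul_comm, map_pow]
      congr
      omega
  obtain ⟨q, hq⟩ := MvPolynomial.esymmAlgHom_surjective (σ := Fin d) K (n := d) (by simp)
    ⟨MvPolynomial.psum (Fin d) K e, MvPolynomial.psum_isSymmetric _ _ _⟩
  have h3 := congrArg (fun q ↦ MvPolynomial.aeval (fun k ↦ p k v) q.1) hq
  simp only [MvPolynomial.esymmAlgHom_apply, MvPolynomial.psum, map_sum, map_pow,
    MvPolynomial.aeval_X, MvPolynomial.comp_aeval_apply] at h3
  rw [conjSum_apply]
  simp only [map_pow]
  rw [← h3]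
  clear h3 hq
  induction q using MvPolynomial.induction_on with
  | C a => simp
  | add a b ha hb => rw [map_add]; exact add_mem ha hb
  | mul_X a i ha => rw [map_mul, MvPolynomial.aeval_X]; exact mul_mem ha (hes _ i.2)

/-- Polarization: sums of conjugates of powers determine sums of conjugates of all products. -/
lemma conjSum_mem (V : Submodule K B) (hV1 : 1 ∈ V) (hV : Algebra.adjoin K (V : Set B) = ⊤)
    (hS : ∀ v ∈ V, ∏ k, p k v ∈ S) (b : B) : conjSum p b ∈ S := by
  have hpow : ∀ v ∈ V, ∀ e, conjSum p (v ^ e) ∈ S := fun v hv e ↦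
    conjSum_pow_mem p S v (fun c ↦ hS _ (add_mem hv (by
      rw [Algebra.algebraMap_eq_smul_one]; exact V.smul_mem c hV1))) e
  have key : ∀ l : List B, (∀ w ∈ l, w ∈ V) → ∀ v ∈ V, ∀ e, conjSum p (l.prod * v ^ e) ∈ S := by
    intro l
    induction l with
    | nil => intro _ v hv e; simpa using hpow v hv e
    | cons w l ih =>
      intro hl v hv e
      -- the coefficient of `c` in the conjugate sum of `l.prod * (v + c w) ^ (e + 1)`
      have := mem_of_forall_sum_pow_smul_mem (K := K) (Subalgebra.toSubmodule S) (e + 1 + 1)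
        (fun m ↦ conjSum p (l.prod * (w ^ m * v ^ (e + 1 - m) * ((e + 1).choose m : B)))) ?_
        (i := 1) (by omega)
      · have h2 : l.prod * (w ^ 1 * v ^ (e + 1 - 1) * ((e + 1).choose 1 : B)) =
            ((e + 1 : ℕ) : K) • ((w :: l).prod * v ^ e) := by
          rw [Algebra.smul_def]
          simp
          ring
        rw [h2, map_smul] at this
        have h3 := Submodule.smul_mem _ (((e + 1 : ℕ) : K)⁻¹) this
        rwa [smul_smul, inv_mul_cancel₀ (by exact_mod_cast e.succ_ne_zero), one_smul] at h3
      · intro c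
        have := ih (fun w hw ↦ hl w (List.mem_cons_of_mem _ hw)) (c • w + v)
          (add_mem (V.smul_mem c (hl w List.mem_cons_self)) hv) (e + 1)
        rw [add_pow, mul_sum, map_sum] at this
        rw [Subalgebra.mem_toSubmodule]
        convert this using 1
        refine sum_congr rfl fun m _ ↦ ?_
        rw [← map_smul, smul_pow]
        simp
  have hb : b ∈ Submodule.span K (Submonoid.closure (V : Set B) : Set B) := by
    rw [← Algebra.adjoin_eq_span, hV]; trivial
  induction hb using Submodule.span_induction with
  | mem x hx =>
    obtain ⟨l, hl, rfl⟩ := Submonoid.exists_list_of_mem_closure hx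
    simpa using key l hl 1 hV1 0
  | zero => simp
  | add x y _ _ hx hy => rw [map_add]; exact add_mem hx hy
  | smul a x _ hx => rw [map_smul]; exact S.smul_mem hx a

omit [CharZero K] in
/-- If `S` contains all sums of conjugates, it contains all sums of products of distinct
conjugates of `j` elements, by induction on `j`. -/
lemma sum_embedding_mem (hP : ∀ b, conjSum p b ∈ S) (j : ℕ) (b : Fin j → B) :
    ∑ f : Fin j ↪ Fin d, ∏ i, p (f i) (b i) ∈ S := by
  classical
  induction j with
  | zero => exact sum_mem fun f _ ↦ by simp
  | succ j ih =>
    have e := sum_equiv (s := univ) (t := univ) (Equiv.embeddingFinSucc j (Fin d))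
      (f := fun f ↦ ∏ i, p (f i) (b i))
      (g := fun f ↦ p f.2 (b 0) * ∏ i, p (f.1 i) (b i.succ)) (by simp) (fun f _ ↦ by
        simp [Fin.prod_univ_succ])
    rw [e, ← univ_sigma_univ, sum_sigma]
    have split : ∀ f : Fin j ↪ Fin d, ∑ k : {k // k ∉ Set.range f}, p k (b 0) =
        conjSum p (b 0) - ∑ i, p (f i) (b 0) := by
      intro f
      rw [conjSum_apply, eq_sub_iff_add_eq,
        ← Fintype.sum_subtype_add_sum_subtype (fun k ↦ k ∉ Set.range f) (fun k ↦ p k (b 0))]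
      congr 1
      exact Fintype.sum_equiv ((Equiv.ofInjective f f.injective).trans
        (Equiv.subtypeEquivRight fun k ↦ not_not.symm)) _ _ fun _ ↦ rfl
    have h2 : ∀ f : Fin j ↪ Fin d, ∑ k : {k // k ∉ Set.range f},
        p k (b 0) * ∏ i, p (f i) (b i.succ) =
        conjSum p (b 0) * ∏ i, p (f i) (b i.succ) -
          ∑ i, ∏ i', p (f i') (Function.update (fun i ↦ b i.succ) i (b 0 * b i.succ) i') := by
      intro f
      rw [← sum_mul, split, sub_mul, sum_mul]
      congr 1
      refine sum_congr rfl fun i _ ↦ ?_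
      rw [← mul_prod_erase univ _ (mem_univ i), ← mul_prod_erase univ (fun i' ↦ p (f i') _)
        (mem_univ i), Function.update_self, map_mul, mul_assoc]
      congr 2
      exact prod_congr rfl fun i' hi' ↦ by rw [Function.update_of_ne (ne_of_mem_erase hi')]
    simp_rw [h2]
    rw [sum_sub_distrib, ← mul_sum, sum_comm]
    exact sub_mem (mul_mem (hP _) (ih _)) (sum_mem fun i _ ↦ ih _)

/-- The sum over all permutations of the conjugate monomials with exponents `I`. -/
def permSum {ι : Type*} (y : ι → B) (I : Fin d → ι) : R :=
  ∑ σ : Equiv.Perm (Fin d), ∏ k, p (σ k) (y (I k))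

/-- **Multisymmetric functions in characteristic zero.** Let `R` be generated by the images of
`d` homomorphisms `p k : B → R`, permuted by a group of automorphisms of `R`. If
the span of the `y i` contains `1` and generates `B`, then the invariants
of `R` are generated by the symmetrizations of the products `∏ p k (y (I k))`. -/
theorem mem_adjoin_permSum {ι : Type*} [Finite ι] (y : ι → B)
    (hy1 : 1 ∈ Submodule.span K (Set.range y)) (hy : Algebra.adjoin K (Set.range y) = ⊤)
    (hR : Algebra.adjoin K (⋃ k, Set.range (p k)) = ⊤)
    (ρ : Equiv.Perm (Fin d) → R →ₐ[K] R) (hρ : ∀ σ k b, ρ σ (p k b) = p (σ k) b)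
    (r : R) (hr : ∀ σ, ρ σ r = r) : r ∈ Algebra.adjoin K (Set.range (permSum p y)) := by
  classical
  have := Fintype.ofFinite ι
  set S := Algebra.adjoin K (Set.range (permSum p y))
  have hd : ((d.factorial : ℕ) : K) ≠ 0 := by exact_mod_cast d.factorial_ne_zero
  have hdiv : ∀ x : R, (d.factorial : K) • x ∈ S → x ∈ S := fun x hx ↦ by
    have := S.smul_mem hx (d.factorial : K)⁻¹
    rwa [smul_smul, inv_mul_cancel₀ hd, one_smul] at this
  have hS : ∀ v ∈ Submodule.span K (Set.range y), ∏ k, p k v ∈ S := by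
    intro v hv
    obtain ⟨a, rfl⟩ := (Submodule.mem_span_range_iff_exists_fun K).1 hv
    apply hdiv
    have h1 : ∀ σ : Equiv.Perm (Fin d), ∏ k, p k (∑ i, a i • y i) =
        ∑ I : Fin d → ι, (∏ k, a (I k)) • ∏ k, p (σ k) (y (I k)) := by
      intro σ
      rw [← Equiv.prod_comp σ]
      simp only [map_sum, map_smul]
      rw [Fintype.prod_sum]
      exact sum_congr rfl fun I _ ↦ by rw [prod_smul]
    have h2 : (d.factorial : K) • ∏ k, p k (∑ i, a i • y i) =
        ∑ I : Fin d → ι, (∏ k, a (I k)) • permSum p y I := by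
      simp_rw [permSum, smul_sum]
      rw [sum_comm, ← sum_congr rfl fun σ _ ↦ h1 σ, sum_const, card_univ, Fintype.card_perm,
        Fintype.card_fin, Nat.cast_smul_eq_nsmul]
    rw [h2]
    exact sum_mem fun I _ ↦ S.smul_mem (Algebra.subset_adjoin ⟨I, rfl⟩) _
  have hP := conjSum_mem p S _ hy1 (by
    rw [eq_top_iff, ← hy]; exact Algebra.adjoin_mono Submodule.subset_span) hS
  -- the Reynolds operator sends products of conjugates into `S`
  have hRey : ∀ x : R, ∑ σ, ρ σ x ∈ S := by
    intro x
    have hx : x ∈ Submodule.span K (Submonoid.closure (⋃ k, Set.range (p k)) : Set R) := by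
      rw [← Algebra.adjoin_eq_span, hR]; trivial
    induction hx using Submodule.span_induction with
    | mem x hx =>
      obtain ⟨b, rfl⟩ : ∃ b : Fin d → B, x = ∏ k, p k (b k) := by
        induction hx using Submonoid.closure_induction with
        | mem x hx =>
          obtain ⟨k, c, rfl⟩ := Set.mem_iUnion.1 hx
          refine ⟨Function.update 1 k c, ?_⟩
          rw [← mul_prod_erase univ _ (mem_univ k), Function.update_self,
            prod_eq_one fun i hi ↦ by simp [Function.update_of_ne (ne_of_mem_erase hi)], mul_one]
        | one => exact ⟨1, by simp⟩
        | mul x y _ _ hx hy =>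
          obtain ⟨b, rfl⟩ := hx
          obtain ⟨c, rfl⟩ := hy
          exact ⟨b * c, by simp [prod_mul_distrib]⟩
      simp only [map_prod, hρ]
      have := sum_embedding_mem p S hP d b
      rwa [← Equiv.sum_comp (Equiv.embeddingEquivOfFinite (Fin d)).symm] at this
    | zero => simp
    | add x y _ _ hx hy =>
      simp only [map_add, sum_add_distrib]; exact add_mem hx hy
    | smul a x _ hx =>
      simp only [map_smul, ← smul_sum]; exact S.smul_mem hx a
  apply hdiv
  have := hRey r
  simp only [hr, sum_const, card_univ, Fintype.card_perm, Fintype.card_fin] at this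
  rwa [Nat.cast_smul_eq_nsmul]

end Multisymmetric

/-! ### Morphisms to `Proj` given by a ring homomorphism inverting a homogeneous element -/

lemma AlgebraicGeometry.Scheme.Hom.appTop_eq_appLE {X Y : Scheme.{u}} (f : X ⟶ Y) :
    f.appTop = f.appLE ⊤ ⊤ f.preimage_top.ge :=
  f.app_eq_appLE

section ChartMap

open HomogeneousLocalization

variable {A σ : Type u} [CommRing A] [SetLike σ A] [AddSubgroupClass σ A] (𝒜 : ℕ → σ)
  [GradedRing 𝒜] {Y Y' : Scheme.{u}}

/-- The homomorphism on the degree zero part of `A[1/x]` induced by a homomorphism `A → R`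
sending `x` to a unit. -/
noncomputable def awayEval {R : Type*} [CommRing R] (e : A →+* R) (x : A) (hx : IsUnit (e x)) :
    Away 𝒜 x →+* R :=
  (IsLocalization.Away.lift x hx : Localization.Away x →+* R).comp
    (algebraMap (Away 𝒜 x) (Localization.Away x))

lemma awayEval_mk {R : Type*} [CommRing R] (e : A →+* R) {x : A} (hx : IsUnit (e x)) {m : ℕ}
    (hm : x ∈ 𝒜 m) (n : ℕ) (a : A) (ha : a ∈ 𝒜 (n • m)) :
    e x ^ n * awayEval 𝒜 e x hx (Away.mk 𝒜 hm n a ha) = e a := by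
  rw [awayEval, RingHom.comp_apply, HomogeneousLocalization.algebraMap_apply, Away.val_mk,
    Localization.mk_eq_mk', IsLocalization.Away.lift, ← map_pow, eq_comm]
  exact (IsLocalization.lift_mk'_spec (M := Submonoid.powers x) (S := Localization.Away x)
    (g := e) _ a _ ⟨x ^ n, n, rfl⟩).1 rfl

lemma awayEval_fromZero {R : Type*} [CommRing R] (e : A →+* R) {x : A} (hx : IsUnit (e x))
    (a : 𝒜 0) : awayEval 𝒜 e x hx (fromZeroRingHom 𝒜 _ a) = e a := by
  rw [awayEval, RingHom.comp_apply, HomogeneousLocalization.algebraMap_apply]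
  exact IsLocalization.lift_eq _ _

/-- Two homomorphisms that differ in degree `n` by the factor `u ^ n` induce the same map in
degree zero. -/
lemma awayEval_eq_of_scaling {R : Type*} [CommRing R] (e e' : A →+* R) {x : A}
    (hx : IsUnit (e x)) {m : ℕ} (hm : x ∈ 𝒜 m) (hx' : IsUnit (e' x)) (u : R)
    (h : ∀ n, ∀ a ∈ 𝒜 n, e' a = u ^ n * e a) : awayEval 𝒜 e x hx = awayEval 𝒜 e' x hx' := by
  ext a
  obtain ⟨n, a, ha, rfl⟩ := Away.mk_surjective 𝒜 hm a
  apply (hx'.pow n).mul_left_cancel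
  rw [awayEval_mk, h _ _ ha, ← awayEval_mk 𝒜 e hx hm n a ha, h _ _ hm, smul_eq_mul]
  ring

lemma awayEval_comp_awayMap {R : Type*} [CommRing R] (e : A →+* R) {x y z : A}
    (hx : IsUnit (e x)) {m m' : ℕ} (hm : x ∈ 𝒜 m) (hm' : y ∈ 𝒜 m') (hz : z = x * y)
    (hez : IsUnit (e z)) :
    (awayEval 𝒜 e z hez).comp (awayMap 𝒜 hm' hz) = awayEval 𝒜 e x hx := by
  ext a
  obtain ⟨n, a, ha, rfl⟩ := Away.mk_surjective 𝒜 hm a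
  rw [RingHom.comp_apply, awayMap_mk]
  apply (hez.pow n).mul_left_cancel
  rw [awayEval_mk, hz, map_mul, map_mul, map_pow, ← awayEval_mk 𝒜 e hx hm n a ha]
  ring

/-- The morphism `Y ⟶ Proj 𝒜` into the chart `D₊(x)` given by a homomorphism `A → Γ(Y, ⊤)`
sending `x` to a unit. -/
noncomputable def chartMap (e : A →+* Γ(Y, ⊤)) {x : A} (hx : IsUnit (e x)) {m : ℕ}
    (hm : x ∈ 𝒜 m) (h0 : 0 < m) : Y ⟶ Proj 𝒜 :=
  Y.toSpecΓ ≫ Spec.map (CommRingCat.ofHom (awayEval 𝒜 e x hx)) ≫ Proj.awayι 𝒜 x hm h0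

lemma comp_chartMap (g : Y' ⟶ Y) (e : A →+* Γ(Y, ⊤)) {x : A} (hx : IsUnit (e x)) {m : ℕ}
    (hm : x ∈ 𝒜 m) (h0 : 0 < m) :
    g ≫ chartMap 𝒜 e hx hm h0 =
      chartMap 𝒜 (g.appTop.hom.comp e) (hx.map g.appTop.hom) hm h0 := by
  rw [chartMap, chartMap, Scheme.toSpecΓ_naturality_assoc, ← Spec.map_comp_assoc]
  congr 3
  ext a
  obtain ⟨n, a, ha, rfl⟩ := Away.mk_surjective 𝒜 hm a
  apply ((hx.map g.appTop.hom).pow n).mul_left_cancel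
  have := awayEval_mk 𝒜 (g.appTop.hom.comp e) (hx.map g.appTop.hom) hm n a ha
  simp only [RingHom.comp_apply] at this
  rw [CommRingCat.hom_ofHom, this, ← awayEval_mk 𝒜 e hx hm n a ha]
  simp

lemma chartMap_eq_mul (e : A →+* Γ(Y, ⊤)) {x y z : A} (hx : IsUnit (e x)) {m m' : ℕ}
    (hm : x ∈ 𝒜 m) (h0 : 0 < m) (hm' : y ∈ 𝒜 m') (hz : z = x * y) (hez : IsUnit (e z)) {k : ℕ}
    (hk : z ∈ 𝒜 k) (hmk : k = m + m') :
    chartMap 𝒜 e hx hm h0 = chartMap 𝒜 e hez hk (by omega) := by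
  subst hmk
  rw [chartMap, chartMap, ← Proj.SpecMap_awayMap_awayι 𝒜 hm h0 hm' hz, ← Spec.map_comp_assoc,
    ← CommRingCat.ofHom_comp, awayEval_comp_awayMap 𝒜 e hx hm hm' hz hez]

/-- Homogeneous coordinates that differ by a unit define the same morphism, whichever chart is used
for either of them. -/
lemma chartMap_eq_of_scaling (e e' : A →+* Γ(Y, ⊤)) {x y : A} (hx : IsUnit (e x))
    {m m' : ℕ} (hm : x ∈ 𝒜 m) (h0 : 0 < m) (hy : IsUnit (e' y)) (hm' : y ∈ 𝒜 m') (h0' : 0 < m')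
    (u : Γ(Y, ⊤)) (hu : IsUnit u) (h : ∀ n, ∀ a ∈ 𝒜 n, e' a = u ^ n * e a) :
    chartMap 𝒜 e hx hm h0 = chartMap 𝒜 e' hy hm' h0' := by
  have hey : IsUnit (e y) := isUnit_of_mul_isUnit_right (h _ _ hm' ▸ hy)
  have hex : IsUnit (e' x) := h _ _ hm ▸ (hu.pow m).mul hx
  have hz : IsUnit (e (x * y)) := map_mul e x y ▸ hx.mul hey
  have hz' : IsUnit (e' (x * y)) := map_mul e' x y ▸ hex.mul hy
  rw [chartMap_eq_mul 𝒜 e hx hm h0 hm' rfl hz (SetLike.mul_mem_graded hm hm') rfl,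
    chartMap_eq_mul 𝒜 e' hy hm' h0' hm (mul_comm x y) hz' (SetLike.mul_mem_graded hm hm')
      (add_comm _ _)]
  rw [chartMap, chartMap,
    awayEval_eq_of_scaling 𝒜 e e' hz (SetLike.mul_mem_graded hm hm') hz' u h]

lemma chartMap_preimage_basicOpen (e : A →+* Γ(Y, ⊤)) {x y : A} (hx : IsUnit (e x))
    {m m' : ℕ} (hm : x ∈ 𝒜 m) (h0 : 0 < m) (hy : y ∈ 𝒜 m') (h0' : 0 < m') :
    chartMap 𝒜 e hx hm h0 ⁻¹ᵁ Proj.basicOpen 𝒜 y = Y.basicOpen (e y) := by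
  rw [chartMap, Scheme.Hom.comp_preimage, Scheme.Hom.comp_preimage,
    Proj.awayι_preimage_basicOpen 𝒜 hm h0 hy h0']
  have : (Spec.map (CommRingCat.ofHom (awayEval 𝒜 e x hx))) ⁻¹ᵁ
      (PrimeSpectrum.basicOpen (Away.isLocalizationElem hm hy)) =
      PrimeSpectrum.basicOpen (awayEval 𝒜 e x hx (Away.isLocalizationElem hm hy)) := rfl
  rw [this, Scheme.toSpecΓ_preimage_basicOpen]
  have h1 := awayEval_mk 𝒜 e hx hm m' (y ^ m)
    (by convert! SetLike.pow_mem_graded m hy using 2; exact mul_comm _ _)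
  have h2 := congrArg Y.basicOpen h1
  rw [Scheme.basicOpen_mul, Scheme.basicOpen_of_isUnit _ (hx.pow m'), map_pow,
    Scheme.basicOpen_pow _ _ h0] at h2
  simpa using h2

lemma chartMap_le_preimage (e : A →+* Γ(Y, ⊤)) {x : A} (hx : IsUnit (e x)) {m : ℕ}
    (hm : x ∈ 𝒜 m) (h0 : 0 < m) : ⊤ ≤ chartMap 𝒜 e hx hm h0 ⁻¹ᵁ Proj.basicOpen 𝒜 x := by
  rw [chartMap_preimage_basicOpen 𝒜 e hx hm h0 hm h0, Scheme.basicOpen_of_isUnit _ hx]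

lemma le_preimage_awayι {x : A} {m : ℕ} (hm : x ∈ 𝒜 m) (h0 : 0 < m) :
    ⊤ ≤ Proj.awayι 𝒜 x hm h0 ⁻¹ᵁ Proj.basicOpen 𝒜 x := by
  rw [← Proj.opensRange_awayι 𝒜 x hm h0, Scheme.Hom.preimage_opensRange]

lemma bijective_awayι_appLE {x : A} {m : ℕ} (hm : x ∈ 𝒜 m) (h0 : 0 < m) :
    Function.Bijective ((Proj.awayι 𝒜 x hm h0).appLE (Proj.basicOpen 𝒜 x) ⊤
      (le_preimage_awayι 𝒜 hm h0)) := by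
  have hr := le_preimage_awayι 𝒜 hm h0
  have : IsIso ((Proj.awayι 𝒜 x hm h0).app (Proj.basicOpen 𝒜 x)) :=
    (Proj.awayι 𝒜 x hm h0).isIso_app _ (Proj.opensRange_awayι 𝒜 x hm h0).ge
  have h2 : IsIso ((Spec (.of (Away 𝒜 x))).presheaf.map (homOfLE hr).op) := by
    have : homOfLE hr = eqToHom (top_le_iff.1 hr).symm := rfl
    rw [this]
    infer_instance
  rw [Scheme.Hom.appLE]
  exact ConcreteCategory.bijective_of_isIso (_ ≫ _)

/-- Every function on the chart `D₊(x)` that comes from the degree zero part of `A[1/x]` is pulled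
back by `chartMap` to its value under `awayEval`. -/
lemma awayEval_mem_range_appLE (e : A →+* Γ(Y, ⊤)) {x : A} (hx : IsUnit (e x)) {m : ℕ}
    (hm : x ∈ 𝒜 m) (h0 : 0 < m) (a : Away 𝒜 x) :
    ∃ b, (chartMap 𝒜 e hx hm h0).appLE (Proj.basicOpen 𝒜 x) ⊤
      (chartMap_le_preimage 𝒜 e hx hm h0) b = awayEval 𝒜 e x hx a := by
  have hr := le_preimage_awayι 𝒜 hm h0
  obtain ⟨b, hb⟩ := (bijective_awayι_appLE 𝒜 hm h0).2
    ((Scheme.ΓSpecIso (.of (Away 𝒜 x))).inv a)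
  refine ⟨b, ?_⟩
  have h3 : (chartMap 𝒜 e hx hm h0).appLE (Proj.basicOpen 𝒜 x) ⊤
      (chartMap_le_preimage 𝒜 e hx hm h0) =
      (Proj.awayι 𝒜 x hm h0).appLE (Proj.basicOpen 𝒜 x) ⊤ hr ≫
      (Spec.map (CommRingCat.ofHom (awayEval 𝒜 e x hx))).appTop ≫ Y.toSpecΓ.appTop := by
    rw [← Scheme.Hom.comp_appTop, Scheme.Hom.appTop_eq_appLE, Scheme.Hom.appLE_comp_appLE]
    simp only [chartMap, Category.assoc]
  rw [h3, CommRingCat.comp_apply, hb, ← CommRingCat.comp_apply, Scheme.toSpecΓ_appTop,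
    Scheme.ΓSpecIso_naturality, Iso.inv_hom_id_assoc]
  rfl

end ChartMap

/-! ### Morphisms to projective space given by charts -/

section ToProjSpace

open HomogeneousLocalization PreimagesQ Limits

variable {K : Type u} [Field K]

lemma appLE_presheaf_map {X Y : Scheme.{u}} (f : X ⟶ Y) {U V : Y.Opens} {W : X.Opens}
    (h : W ≤ f ⁻¹ᵁ V) (i : V ⟶ U) (s : Γ(Y, U)) :
    f.appLE V W h (Y.presheaf.map i.op s) =
      f.appLE U W (h.trans (f.preimage_mono (leOfHom i))) s :=
  congr(($(f.map_appLE h i.op)).hom s)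

lemma presheaf_map_appLE {X Y : Scheme.{u}} (f : X ⟶ Y) {U : Y.Opens} {V W : X.Opens}
    (h : V ≤ f ⁻¹ᵁ U) (i : W ⟶ V) (s : Γ(Y, U)) :
    X.presheaf.map i.op (f.appLE U V h s) = f.appLE U W ((leOfHom i).trans h) s :=
  congr(($(f.appLE_map h i.op)).hom s)

lemma appLE_appLE {X Y Z : Scheme.{u}} (f : X ⟶ Y) (g : Y ⟶ Z) {U : Z.Opens} {V : Y.Opens}
    {W : X.Opens} (h : W ≤ f ⁻¹ᵁ V) (h' : V ≤ g ⁻¹ᵁ U) (s : Γ(Z, U)) :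
    f.appLE V W h (g.appLE U V h' s) = (f ≫ g).appLE U W (h.trans (f.preimage_mono h')) s :=
  congr(($(Scheme.Hom.appLE_comp_appLE f g U V W h' h)).hom s)

/-- The scalars `K → Γ(Y, V)` of a scheme over `K`. -/
noncomputable def scalars {Y : Scheme.{u}} (q : Y ⟶ Spec (CommRingCat.of K)) (V : Y.Opens) :
    K →+* Γ(Y, V) :=
  ((Scheme.ΓSpecIso (CommRingCat.of K)).inv ≫ q.appLE ⊤ V le_top).hom

lemma appLE_scalars {Y Y' : Scheme.{u}} (q : Y ⟶ Spec (CommRingCat.of K)) (g : Y' ⟶ Y)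
    (V : Y.Opens) (V' : Y'.Opens) (h : V' ≤ g ⁻¹ᵁ V) (c : K) :
    g.appLE V V' h (scalars q V c) = scalars (g ≫ q) V' c := by
  exact appLE_appLE g q h le_top ((Scheme.ΓSpecIso (CommRingCat.of K)).inv c)

lemma le_preimage_comp {X Y Z : Scheme.{u}} (f : X ⟶ Y) (g : Y ⟶ Z) {U : Z.Opens}
    (h : ⊤ ≤ g ⁻¹ᵁ U) : ⊤ ≤ (f ≫ g) ⁻¹ᵁ U :=
  f.preimage_mono h

lemma toSpecΓ_scalars {Y : Scheme.{u}} (q : Y ⟶ Spec (CommRingCat.of K)) :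
    Y.toSpecΓ ≫ Spec.map (CommRingCat.ofHom (scalars q ⊤)) = q := by
  have h : CommRingCat.ofHom (scalars q ⊤) =
      (Scheme.ΓSpecIso (CommRingCat.of K)).inv ≫ q.appTop := by
    rw [Scheme.Hom.appTop_eq_appLE]; rfl
  rw [h, Spec.map_comp, ← Scheme.toSpecΓ_naturality_assoc]
  simp

/-- The standard grading of `K[x₀, …, xₙ]`. -/
abbrev stdGrading (K : Type u) [Field K] (n : ℕ) :=
  MvPolynomial.homogeneousSubmodule (Fin (n + 1)) K

/-- The structure morphism of `Proj K[x₀, …, xₙ]`. -/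
noncomputable abbrev projStr (K : Type u) [Field K] (n : ℕ) :
    Proj (stdGrading K n) ⟶ Spec (CommRingCat.of K) :=
  Proj.toSpecZero (stdGrading K n) ≫
    Spec.map (CommRingCat.ofHom (algebraMap K (stdGrading K n 0)))

lemma X_mem_stdGrading {n : ℕ} (i : Fin (n + 1)) :
    (MvPolynomial.X i : MvPolynomial (Fin (n + 1)) K) ∈ stdGrading K n 1 :=
  MvPolynomial.isHomogeneous_X _ _

lemma eval₂Hom_mul_of_isHomogeneous {ι R : Type*} [CommRing R] (f : K →+* R) (u : R) (v : ι → R)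
    {a : MvPolynomial ι K} {m : ℕ} (ha : a.IsHomogeneous m) :
    MvPolynomial.eval₂Hom f (fun i ↦ u * v i) a = u ^ m * MvPolynomial.eval₂Hom f v a := by
  simp only [MvPolynomial.coe_eval₂Hom, MvPolynomial.eval₂_eq]
  rw [Finset.mul_sum]
  refine Finset.sum_congr rfl fun k hk ↦ ?_
  have hm : ∑ i ∈ k.support, k i = m := by
    rw [← ha (MvPolynomial.mem_support_iff.1 hk)]
    simp [Finsupp.weight_apply, Finsupp.sum]
  simp_rw [mul_pow, Finset.prod_mul_distrib, Finset.prod_pow_eq_pow_sum]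
  rw [hm]
  ring

/-- The data of a morphism from a `K`-scheme to projective space: opens `U t`, and on `U t` the
functions `s t i = xᵢ / x_{e t}`, where `U t` is to be the preimage of the chart `x_{e t} ≠ 0`. Not
every coordinate needs to occur as some `e t`: the opens `U t` have to cover `P`, but the charts
`x_{e t} ≠ 0` need not cover projective space. -/
structure ProjCharts (P : Over (Spec (CommRingCat.of K))) (n : ℕ) (T : Type*) where
  U : T → P.left.Opens
  iSup_U : ⨆ t, U t = ⊤
  e : T → Fin (n + 1)
  s : ∀ t, Fin (n + 1) → Γ(P.left, U t)
  s_self : ∀ t, s t (e t) = 1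
  cocycle : ∀ t t' i, P.left.presheaf.map (homOfLE inf_le_left : U t ⊓ U t' ⟶ U t).op (s t i) =
    P.left.presheaf.map (homOfLE inf_le_left : U t ⊓ U t' ⟶ U t).op (s t (e t')) *
    P.left.presheaf.map (homOfLE inf_le_right : U t ⊓ U t' ⟶ U t').op (s t' i)
  basicOpen_s : ∀ t t', P.left.basicOpen (s t (e t')) = U t ⊓ U t'

namespace ProjCharts

variable {P : Over (Spec (CommRingCat.of K))} {n : ℕ} {T : Type*} (D : ProjCharts P n T)
  {Y Y' : Scheme.{u}}

/-- Evaluation of polynomials at the functions `s t i`, pulled back along a morphism `y` that maps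
into `U t`. -/
noncomputable def eval (t : T) (y : Y ⟶ P.left) (h : ⊤ ≤ y ⁻¹ᵁ D.U t) :
    MvPolynomial (Fin (n + 1)) K →+* Γ(Y, ⊤) :=
  MvPolynomial.eval₂Hom (scalars (y ≫ P.hom) ⊤) (fun i ↦ y.appLE (D.U t) ⊤ h (D.s t i))

lemma isUnit_eval (t : T) (y : Y ⟶ P.left) (h : ⊤ ≤ y ⁻¹ᵁ D.U t) :
    IsUnit (D.eval t y h (MvPolynomial.X (D.e t))) := by
  simp [eval, D.s_self]

/-- The morphism `[s t 0 : … : s t n]` on a scheme over `U t`. -/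
noncomputable def chart (t : T) (y : Y ⟶ P.left) (h : ⊤ ≤ y ⁻¹ᵁ D.U t) :
    Y ⟶ Proj (stdGrading K n) :=
  chartMap (stdGrading K n) (D.eval t y h) (D.isUnit_eval t y h)
    (X_mem_stdGrading (D.e t)) one_pos

lemma comp_chart (g : Y' ⟶ Y) (t : T) (y : Y ⟶ P.left) (h : ⊤ ≤ y ⁻¹ᵁ D.U t) :
    g ≫ D.chart t y h = D.chart t (g ≫ y) (le_preimage_comp g y h) := by
  rw [chart, comp_chartMap]
  have : g.appTop.hom.comp (D.eval t y h) =
      D.eval t (g ≫ y) (le_preimage_comp g y h) := by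
    refine MvPolynomial.ringHom_ext (fun c ↦ ?_) fun i ↦ ?_
    · simp [eval, Scheme.Hom.appTop_eq_appLE, appLE_scalars]
    · simp only [eval, Scheme.Hom.appTop_eq_appLE, RingHom.comp_apply, MvPolynomial.eval₂Hom_X',
        appLE_appLE]
  simp only [this, chart]

lemma chart_eq (t t' : T) (y : Y ⟶ P.left) (h : ⊤ ≤ y ⁻¹ᵁ D.U t) (h' : ⊤ ≤ y ⁻¹ᵁ D.U t') :
    D.chart t y h = D.chart t' y h' := by
  have hs : ∀ i, y.appLE (D.U t) ⊤ h (D.s t i) =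
      y.appLE (D.U t) ⊤ h (D.s t (D.e t')) * y.appLE (D.U t') ⊤ h' (D.s t' i) := by
    intro i
    have hh : ⊤ ≤ y ⁻¹ᵁ (D.U t ⊓ D.U t') := le_inf h h'
    have := congrArg (y.appLE (D.U t ⊓ D.U t') ⊤ hh) (D.cocycle t t' i)
    rw [map_mul] at this
    simpa only [appLE_presheaf_map] using this
  symm
  refine chartMap_eq_of_scaling (stdGrading K n) _ _ _ _ _ _ _ _
    (y.appLE (D.U t) ⊤ h (D.s t (D.e t'))) ?_ ?_
  · have := hs (D.e t)
    rw [D.s_self, map_one] at this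
    exact .of_mul_eq_one _ this.symm
  · intro m a ha
    rw [eval, eval, ← eval₂Hom_mul_of_isHomogeneous _ _ _ ha, ← funext hs]

lemma chart_hom (t : T) (y : Y ⟶ P.left) (h : ⊤ ≤ y ⁻¹ᵁ D.U t) :
    D.chart t y h ≫ projStr K n = y ≫ P.hom := by
  rw [chart, chartMap]
  simp only [Category.assoc, Proj.awayι_toSpecZero_assoc, ← Spec.map_comp]
  rw [← toSpecΓ_scalars (y ≫ P.hom)]
  congr 2
  ext c
  simp only [CommRingCat.hom_comp, CommRingCat.hom_ofHom, RingHom.comp_apply, awayEval_fromZero]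
  exact MvPolynomial.eval₂Hom_C _ _ _

lemma chart_preimage (t : T) (y : Y ⟶ P.left) (h : ⊤ ≤ y ⁻¹ᵁ D.U t) (i : Fin (n + 1)) :
    D.chart t y h ⁻¹ᵁ Proj.basicOpen (stdGrading K n) (MvPolynomial.X i) =
      Y.basicOpen (y.appLE (D.U t) ⊤ h (D.s t i)) := by
  rw [chart, chartMap_preimage_basicOpen _ _ _ _ _ (X_mem_stdGrading i) one_pos, eval,
    MvPolynomial.eval₂Hom_X']

lemma le_preimage_ι (t : T) : ⊤ ≤ (D.U t).ι ⁻¹ᵁ D.U t := by simp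

lemma exists_hom : ∃ c : P.left ⟶ Proj (stdGrading K n), c ≫ projStr K n = P.hom ∧ ∀ t,
    (D.U t).ι ≫ c = D.chart t (D.U t).ι (D.le_preimage_ι t) := by
  have key : ∀ t t' : T, pullback.fst (D.U t).ι (D.U t').ι ≫
      D.chart t (D.U t).ι (D.le_preimage_ι t) = pullback.snd (D.U t).ι (D.U t').ι ≫
      D.chart t' (D.U t').ι (D.le_preimage_ι t') := by
    intro t t'
    rw [D.comp_chart, D.comp_chart]
    have h : ⊤ ≤ (pullback.fst (D.U t).ι (D.U t').ι ≫ (D.U t).ι) ⁻¹ᵁ D.U t' := by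
      rw [pullback.condition]
      exact le_preimage_comp _ _ (D.le_preimage_ι t')
    rw [D.chart_eq t t' _ _ h]
    simp only [pullback.condition]
  let 𝒰 := P.left.openCoverOfIsOpenCover D.U D.iSup_U
  let c := 𝒰.glueMorphisms (fun t ↦ D.chart t (D.U t).ι (D.le_preimage_ι t)) key
  have hc : ∀ t, (D.U t).ι ≫ c = D.chart t (D.U t).ι (D.le_preimage_ι t) := fun t ↦
    𝒰.ι_glueMorphisms _ _ t
  have hc' : ∀ t, (D.U t).ι ≫ c ≫ projStr K n = (D.U t).ι ≫ P.hom := fun t ↦ by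
    rw [← Category.assoc, hc, chart_hom]
  exact ⟨c, 𝒰.hom_ext _ _ hc', hc⟩

/-- The morphism to projective space with the given charts. -/
noncomputable def hom : P.left ⟶ Proj (stdGrading K n) := D.exists_hom.choose

lemma hom_projStr : D.hom ≫ projStr K n = P.hom := D.exists_hom.choose_spec.1

lemma ι_hom (t : T) : (D.U t).ι ≫ D.hom = D.chart t (D.U t).ι (D.le_preimage_ι t) :=
  D.exists_hom.choose_spec.2 t

/-- The standard chart `x_{e t} ≠ 0`. -/
noncomputable abbrev target (t : T) : (Proj (stdGrading K n)).Opens :=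
  Proj.basicOpen (stdGrading K n) (MvPolynomial.X (D.e t))

lemma isAffineOpen_target (t : T) : IsAffineOpen (D.target t) :=
  Proj.isAffineOpen_basicOpen (stdGrading K n) _ (X_mem_stdGrading _) one_pos

lemma preimage_target (t : T) : D.hom ⁻¹ᵁ D.target t = D.U t := by
  ext p
  obtain ⟨t', ht'⟩ := TopologicalSpace.Opens.mem_iSup.1
    (D.iSup_U.ge (TopologicalSpace.Opens.mem_top p))
  obtain ⟨x, rfl⟩ : ∃ x, (D.U t').ι x = p := ⟨⟨p, ht'⟩, rfl⟩
  have h1 : (D.U t').ι ⁻¹ᵁ (D.hom ⁻¹ᵁ D.target t) = (D.U t').ι ⁻¹ᵁ (D.U t' ⊓ D.U t) := by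
    rw [← Scheme.Hom.comp_preimage, ι_hom, chart_preimage, ← D.basicOpen_s t' t,
      Scheme.basicOpen_appLE, top_inf_eq]
  have := congrArg (x ∈ ·) h1
  simp only [eq_iff_iff] at this
  refine this.trans ?_
  exact ⟨fun h ↦ h.2, fun h ↦ ⟨ht', h⟩⟩

lemma exists_appLE_eq (t : T) (i : Fin (n + 1)) :
    ∃ b, D.hom.appLE (D.target t) (D.U t) (D.preimage_target t).ge b = D.s t i := by
  obtain ⟨b, hb⟩ := awayEval_mem_range_appLE (stdGrading K n)
    (D.eval t (D.U t).ι (D.le_preimage_ι t)) (D.isUnit_eval _ _ _) (X_mem_stdGrading (D.e t))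
    one_pos (Away.mk _ (X_mem_stdGrading (D.e t)) 1 (MvPolynomial.X i) (X_mem_stdGrading i))
  refine ⟨b, ?_⟩
  have h1 := awayEval_mk (stdGrading K n) (D.eval t (D.U t).ι (D.le_preimage_ι t))
    (D.isUnit_eval _ _ _) (X_mem_stdGrading (D.e t)) 1 (MvPolynomial.X i) (X_mem_stdGrading i)
  have h2 : (D.U t).ι.appLE (D.U t) ⊤ (D.le_preimage_ι t)
      (D.hom.appLE (D.target t) (D.U t) (D.preimage_target t).ge b) =
      (D.U t).ι.appLE (D.U t) ⊤ (D.le_preimage_ι t) (D.s t i) := by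
    rw [appLE_appLE]
    simp only [ι_hom, chart]
    rw [hb]
    simpa [eval, D.s_self] using h1
  refine (ConcreteCategory.bijective_of_isIso
    ((D.U t).ι.appLE (D.U t) ⊤ (D.le_preimage_ι t))).1 h2

end ProjCharts

end ToProjSpace

/-! ### Linear forms in general position -/

section LinearForms

open HomogeneousLocalization PreimagesQ Limits MvPolynomial

variable (K : Type u) [Field K] (n : ℕ)

/-- The linear form `∑ tⁱ xᵢ`. In characteristic zero, any `n + 1` of these form a basis of
the linear forms, by the nonvanishing of Vandermonde determinants. -/
noncomputable def linForm (t : ℕ) : MvPolynomial (Fin (n + 1)) K :=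
  ∑ i : Fin (n + 1), C ((t : K) ^ (i : ℕ)) * X i

lemma linForm_mem (t : ℕ) : linForm K n t ∈ stdGrading K n 1 :=
  sum_mem fun i _ ↦ by
    simpa using (isHomogeneous_C _ ((t : K) ^ (i : ℕ))).mul (isHomogeneous_X K i)

variable {K n}

lemma X_mem_span_linForm [CharZero K] {m : ℕ} (hm : n ≤ m) (i : Fin (n + 1)) :
    (X i : MvPolynomial (Fin (n + 1)) K) ∈
      Submodule.span K (Set.range fun s : Fin (m + 1) ↦ linForm K n s) := by
  classical
  have := mem_of_forall_mem_sum_pow_smul_mem (Submodule.span K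
    (Set.range fun s : Fin (m + 1) ↦ linForm K n s)) (n + 1)
    (fun i ↦ if h : i < n + 1 then X ⟨i, h⟩ else 0)
    ((Finset.range (m + 1)).image (Nat.cast : ℕ → K))
    (by rw [Finset.card_image_of_injective _ Nat.cast_injective, Finset.card_range]; omega)
    (fun c hc ↦ ?_) i.2
  · rwa [dif_pos i.2] at this
  · obtain ⟨s, hs, rfl⟩ := Finset.mem_image.1 hc
    refine Submodule.subset_span ⟨⟨s, Finset.mem_range.1 hs⟩, ?_⟩
    rw [Finset.sum_range]
    exact Finset.sum_congr rfl fun j _ ↦ by rw [dif_pos j.2, smul_eq_C_mul]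

variable (K n) in
lemma iSup_basicOpen_X : ⨆ i, Proj.basicOpen (stdGrading K n) (X i) = ⊤ := by
  refine Proj.iSup_basicOpen_eq_top' _ _ (fun i ↦ ⟨1, X_mem_stdGrading i⟩) ?_
  rw [eq_top_iff]
  intro a _
  induction a using MvPolynomial.induction_on with
  | C c =>
    exact Subalgebra.algebraMap_mem (R := stdGrading K n 0) _
      ⟨C c, isHomogeneous_C _ c⟩
  | add p q hp hq => exact add_mem (hp trivial) (hq trivial)
  | mul_X p i hp => exact mul_mem (hp trivial) (Algebra.subset_adjoin ⟨i, rfl⟩)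

/-- A point of projective space lies on at most `n` of the hyperplanes `linForm K n t = 0`: these
`t` are roots of the polynomial of degree `n` whose coefficients are the coordinates. -/
lemma card_linForm_vanishing_le [CharZero K] (p : Proj (stdGrading K n)) (m : ℕ)
    [DecidablePred fun t : Fin (m + 1) ↦ p ∉ Proj.basicOpen (stdGrading K n) (linForm K n t)] :
    (Finset.univ.filter fun t : Fin (m + 1) ↦
      p ∉ Proj.basicOpen (stdGrading K n) (linForm K n t)).card ≤ n := by
  classical
  let I := p.asHomogeneousIdeal.toIdeal
  have : I.IsPrime := p.isPrime
  let q : Polynomial (MvPolynomial (Fin (n + 1)) K ⧸ I) :=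
    ∑ i : Fin (n + 1), Polynomial.monomial (i : ℕ) (Ideal.Quotient.mk I (X i))
  have hq : q ≠ 0 := by
    intro h0
    obtain ⟨i, hi⟩ := TopologicalSpace.Opens.mem_iSup.1
      ((iSup_basicOpen_X K n).ge (TopologicalSpace.Opens.mem_top p))
    refine (Proj.mem_basicOpen _ _ _).1 hi ?_
    change X i ∈ I
    have := congrArg (fun r ↦ Polynomial.coeff r i) h0
    simpa [q, Polynomial.finsetSum_coeff, Polynomial.coeff_monomial, Fin.val_inj,
      Ideal.Quotient.eq_zero_iff_mem] using this
  have hdeg : q.natDegree ≤ n := by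
    refine Polynomial.natDegree_sum_le_of_forall_le _ _ fun i _ ↦
      (Polynomial.natDegree_monomial_le _).trans (Nat.lt_succ_iff.1 i.2)
  refine le_trans ?_ ((Polynomial.card_roots' q).trans hdeg)
  refine le_trans ?_ q.roots.toFinset_card_le
  refine Finset.card_le_card_of_injOn (fun t ↦ Ideal.Quotient.mk I (C ((t : ℕ) : K))) ?_ ?_
  · intro t ht
    have ht : linForm K n t ∈ I := by
      change linForm K n t ∈ p.asHomogeneousIdeal
      simpa [Proj.mem_basicOpen] using ht
    rw [Finset.mem_coe, Multiset.mem_toFinset, Polynomial.mem_roots hq, Polynomial.IsRoot.def,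
      ← Ideal.Quotient.eq_zero_iff_mem.2 ht]
    simp [q, linForm, Polynomial.eval_finsetSum, mul_comm]
  · intro t _ t' _ h
    have hinj : Function.Injective ((Ideal.Quotient.mk I).comp C : K →+* _) := RingHom.injective _
    exact Fin.ext (Nat.cast_injective (hinj h))

variable (K n) in
/-- The quotient of two of the linear forms, as an element of the chart. -/
noncomputable def linFrac (t s : ℕ) : Away (stdGrading K n) (linForm K n t) :=
  Away.mk _ (linForm_mem K n t) 1 (linForm K n s) (linForm_mem K n s)

lemma val_away_mk {A σ : Type*} [CommRing A] [SetLike σ A] [AddSubgroupClass σ A] (𝒜 : ℕ → σ)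
    [GradedRing 𝒜] {x : A} {m : ℕ} (hm : x ∈ 𝒜 m) (k : ℕ) (a : A) (ha : a ∈ 𝒜 (k • m)) :
    (Away.mk 𝒜 hm k a ha).val = algebraMap A (Localization.Away x) a *
      IsLocalization.Away.invSelf x ^ k := by
  rw [Away.val_mk, Localization.mk_eq_mk', IsLocalization.mk'_eq_iff_eq_mul]
  simp only [map_pow]
  rw [mul_assoc, ← mul_pow, mul_comm (IsLocalization.Away.invSelf x),
    IsLocalization.Away.mul_invSelf, one_pow, mul_one]

/-- The coordinate ring of the chart `linForm t ≠ 0` is generated by the quotients of the linear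
forms, since these span the coordinates `xᵢ`. -/
lemma surjective_eval_linFrac [CharZero K] {m : ℕ} (hm : n ≤ m) (t : ℕ) :
    Function.Surjective (eval₂Hom ((fromZeroRingHom (stdGrading K n) _).comp
      (algebraMap K (stdGrading K n 0))) fun s : Fin (m + 1) ↦ linFrac K n t s) := by
  set κ : K →+* Away (stdGrading K n) (linForm K n t) :=
    (fromZeroRingHom (stdGrading K n) (Submonoid.powers (linForm K n t))).comp
      (algebraMap K (stdGrading K n 0))
  set ψ := eval₂Hom κ fun s : Fin (m + 1) ↦ linFrac K n t s
  let ν : Away (stdGrading K n) (linForm K n t) →+* Localization.Away (linForm K n t) :=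
    algebraMap _ _
  have hν : Function.Injective ν := val_injective _
  let w : Localization.Away (linForm K n t) := IsLocalization.Away.invSelf (linForm K n t)
  have hκ : ∀ c, ν (κ c) = algebraMap (MvPolynomial (Fin (n + 1)) K) _ (C c) := fun c ↦ rfl
  let x : Fin (n + 1) → Away (stdGrading K n) (linForm K n t) := fun i ↦
    Away.mk _ (linForm_mem K n t) 1 (X i) (X_mem_stdGrading i)
  have hνx : ∀ i, ν (x i) = w * algebraMap _ _ (X i) := fun i ↦
    (val_away_mk (stdGrading K n) (linForm_mem K n t) 1 _ _).trans (by rw [pow_one, mul_comm])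
  have hx : ∀ i, ∃ F, ψ F = x i := by
    intro i
    obtain ⟨c, hc⟩ := (Submodule.mem_span_range_iff_exists_fun K).1 (X_mem_span_linForm hm i)
    refine ⟨∑ s, C (c s) * X s, hν ?_⟩
    have h1 : ∀ s : ℕ, ν (linFrac K n t s) = w * algebraMap _ _ (linForm K n s) := fun s ↦
      (val_away_mk (stdGrading K n) (linForm_mem K n t) 1 _ _).trans (by rw [pow_one, mul_comm])
    rw [hνx, ← hc]
    simp only [ψ, map_sum, map_mul, coe_eval₂Hom, eval₂_C, eval₂_X, hκ, h1,
      Finset.mul_sum, smul_eq_C_mul]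
    exact Finset.sum_congr rfl fun s _ ↦ by ring
  choose F hF using hx
  intro a
  obtain ⟨k, a, ha, rfl⟩ := Away.mk_surjective _ (linForm_mem K n t) a
  have ha' : a.IsHomogeneous k := by simpa using ha
  refine ⟨bind₁ F a, hν ?_⟩
  have h2 : (ν.comp ψ).comp (bind₁ F).toRingHom =
      eval₂Hom (ν.comp κ) fun i ↦ w * algebraMap (MvPolynomial (Fin (n + 1)) K) _ (X i) := by
    refine ringHom_ext (fun c ↦ ?_) fun i ↦ ?_
    · simp [ψ]
    · simp only [RingHom.comp_apply, AlgHom.toRingHom_eq_coe, RingHom.coe_coe, bind₁_X_right, hF,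
        hνx, eval₂Hom_X']
  have h3 : eval₂Hom (ν.comp κ) (fun i ↦ algebraMap (MvPolynomial (Fin (n + 1)) K)
      (Localization.Away (linForm K n t)) (X i)) =
      algebraMap (MvPolynomial (Fin (n + 1)) K) (Localization.Away (linForm K n t)) :=
    ringHom_ext (fun c ↦ by simp [hκ]) fun i ↦ by simp
  refine congr($h2 a).trans ?_
  rw [eval₂Hom_mul_of_isHomogeneous _ _ _ ha', h3]
  exact (mul_comm _ _).trans (val_away_mk (stdGrading K n) (linForm_mem K n t) k a ha).symm

end LinearForms

/-! ### Charts of projective space and of its closed subschemes -/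

section LinCharts

open HomogeneousLocalization PreimagesQ Limits MvPolynomial

lemma presheaf_map_map {X : Scheme.{u}} {U V W : X.Opens} (i : V ⟶ U) (j : W ⟶ V) (s : Γ(X, U)) :
    X.presheaf.map j.op (X.presheaf.map i.op s) = X.presheaf.map (j ≫ i).op s :=
  congr(($(X.presheaf.map_comp i.op j.op)).hom s).symm

lemma awayι_appLE_awayToSection {A σ : Type u} [CommRing A] [SetLike σ A]
    [AddSubgroupClass σ A] (𝒜 : ℕ → σ) [GradedRing 𝒜] {x : A} {m : ℕ} (hm : x ∈ 𝒜 m)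
    (h0 : 0 < m) :
    Proj.awayToSection 𝒜 x ≫ (Proj.awayι 𝒜 x hm h0).appLE (Proj.basicOpen 𝒜 x) ⊤
      (le_preimage_awayι 𝒜 hm h0) = (Scheme.ΓSpecIso (.of (Away 𝒜 x))).inv := by
  have h1 : (Proj.basicOpenIsoSpec 𝒜 x hm h0).hom.appTop =
      (Scheme.ΓSpecIso _).hom ≫ Proj.awayToSection 𝒜 x ≫ (Proj.basicOpen 𝒜 x).topIso.inv :=
    Proj.basicOpenToSpec_app_top 𝒜 x
  have h2 : (Proj.awayι 𝒜 x hm h0).appLE (Proj.basicOpen 𝒜 x) ⊤ (le_preimage_awayι 𝒜 hm h0) =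
      (Proj.basicOpen 𝒜 x).topIso.inv ≫ (Proj.basicOpenIsoSpec 𝒜 x hm h0).inv.appTop := by
    have h3 : (Proj.basicOpen 𝒜 x).topIso.inv = (Proj.basicOpen 𝒜 x).ι.appLE
        (Proj.basicOpen 𝒜 x) ⊤ (by simp) := by
      simp [Scheme.Opens.topIso_inv]
      rfl
    rw [h3, Scheme.Hom.appTop_eq_appLE, Scheme.Hom.appLE_comp_appLE]
    rfl
  rw [h2, ← cancel_epi (Scheme.ΓSpecIso (.of (Away 𝒜 x))).hom, Iso.hom_inv_id]
  have h3 : (Proj.basicOpenIsoSpec 𝒜 x hm h0).hom.appTop ≫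
      (Proj.basicOpenIsoSpec 𝒜 x hm h0).inv.appTop = 𝟙 _ := by
    rw [← Scheme.Hom.comp_appTop, Iso.inv_hom_id, Scheme.Hom.id_appTop]
  rw [← h3, h1]
  simp only [Category.assoc]

lemma bijective_awayToSection {A σ : Type u} [CommRing A] [SetLike σ A] [AddSubgroupClass σ A]
    (𝒜 : ℕ → σ) [GradedRing 𝒜] {x : A} {m : ℕ} (hm : x ∈ 𝒜 m) (h0 : 0 < m) :
    Function.Bijective (Proj.awayToSection 𝒜 x) := by
  have h := bijective_awayι_appLE 𝒜 hm h0
  have h2 : Function.Bijective (Scheme.ΓSpecIso (.of (Away 𝒜 x))).inv :=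
    ConcreteCategory.bijective_of_isIso _
  rw [← awayι_appLE_awayToSection 𝒜 hm h0] at h2
  exact (Function.Bijective.of_comp_iff' h _).1 (by simpa using h2)

variable {K : Type u} [Field K] {n : ℕ}

lemma awayToSection_algebraMap {x : MvPolynomial (Fin (n + 1)) K} {m : ℕ}
    (hm : x ∈ stdGrading K n m) (h0 : 0 < m) (c : K) :
    Proj.awayToSection (stdGrading K n) x
      (fromZeroRingHom (stdGrading K n) (Submonoid.powers x) (algebraMap K _ c)) =
      scalars (projStr K n) (Proj.basicOpen (stdGrading K n) x) c := by
  apply (bijective_awayι_appLE (stdGrading K n) hm h0).1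
  rw [appLE_scalars, ← CommRingCat.comp_apply, awayι_appLE_awayToSection]
  simp only [Proj.awayι_toSpecZero_assoc, ← Spec.map_comp]
  rw [scalars, ← Scheme.Hom.appTop_eq_appLE, ← Scheme.ΓSpecIso_inv_naturality]
  rfl

variable (K n) in
/-- The function `linForm s / linForm t` on the chart `linForm t ≠ 0` of projective space. -/
noncomputable def linSec (t s : ℕ) :
    Γ(Proj (stdGrading K n), Proj.basicOpen (stdGrading K n) (linForm K n t)) :=
  Proj.awayToSection (stdGrading K n) (linForm K n t) (linFrac K n t s)

lemma linSec_self (t : ℕ) : linSec K n t t = 1 := by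
  have : linFrac K n t t = 1 := by
    apply HomogeneousLocalization.val_injective
    rw [linFrac, val_away_mk, pow_one, IsLocalization.Away.mul_invSelf, val_one]
  rw [linSec, this, map_one]

lemma awayMap_linFrac (t t' i : ℕ) :
    awayMap (stdGrading K n) (linForm_mem K n t') rfl (linFrac K n t i) =
      awayMap (stdGrading K n) (linForm_mem K n t') rfl (linFrac K n t t') *
      awayMap (stdGrading K n) (linForm_mem K n t) (mul_comm _ _) (linFrac K n t' i) := by
  simp only [linFrac, awayMap_mk]
  apply HomogeneousLocalization.val_injective
  rw [val_mul, val_away_mk, val_away_mk, val_away_mk]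
  have h := IsLocalization.Away.mul_invSelf
    (S := Localization.Away (linForm K n t * linForm K n t')) (linForm K n t * linForm K n t')
  simp only [map_mul, pow_one] at h ⊢
  linear_combination (- (algebraMap _ (Localization.Away (linForm K n t * linForm K n t'))
    (linForm K n i) * algebraMap _ _ (linForm K n t') *
    IsLocalization.Away.invSelf (linForm K n t * linForm K n t'))) * h

lemma linSec_cocycle (t t' i : ℕ) {W : (Proj (stdGrading K n)).Opens}
    (h : W ≤ Proj.basicOpen (stdGrading K n) (linForm K n t))
    (h' : W ≤ Proj.basicOpen (stdGrading K n) (linForm K n t')) :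
    (Proj (stdGrading K n)).presheaf.map (homOfLE h).op (linSec K n t i) =
      (Proj (stdGrading K n)).presheaf.map (homOfLE h).op (linSec K n t t') *
      (Proj (stdGrading K n)).presheaf.map (homOfLE h').op (linSec K n t' i) := by
  have hW : W ≤ Proj.basicOpen (stdGrading K n) (linForm K n t * linForm K n t') := by
    rw [Proj.basicOpen_mul]; exact le_inf h h'
  have key : ∀ i, (Proj (stdGrading K n)).presheaf.map (homOfLE h).op (linSec K n t i) =
      (Proj (stdGrading K n)).presheaf.map (homOfLE hW).op
        (Proj.awayToSection (stdGrading K n) _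
          (awayMap (stdGrading K n) (linForm_mem K n t') rfl (linFrac K n t i))) := fun i ↦ by
    have := congr($(Proj.awayMap_awayToSection (stdGrading K n) (linForm_mem K n t')
      (f := linForm K n t) rfl) (linFrac K n t i))
    refine .trans ?_ (congrArg ((Proj (stdGrading K n)).presheaf.map (homOfLE hW).op) this.symm)
    exact (presheaf_map_map _ _ _).symm
  have key' : (Proj (stdGrading K n)).presheaf.map (homOfLE h').op (linSec K n t' i) =
      (Proj (stdGrading K n)).presheaf.map (homOfLE hW).op
        (Proj.awayToSection (stdGrading K n) _
          (awayMap (stdGrading K n) (linForm_mem K n t) (mul_comm _ _) (linFrac K n t' i))) := by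
    have := congr($(Proj.awayMap_awayToSection (stdGrading K n) (linForm_mem K n t)
      (f := linForm K n t') (mul_comm _ _)) (linFrac K n t' i))
    refine .trans ?_ (congrArg ((Proj (stdGrading K n)).presheaf.map (homOfLE hW).op) this.symm)
    exact (presheaf_map_map _ _ _).symm
  rw [key, key, key', ← map_mul, ← map_mul, awayMap_linFrac]

lemma basicOpen_linSec (t t' : ℕ) :
    (Proj (stdGrading K n)).basicOpen (linSec K n t t') =
      Proj.basicOpen (stdGrading K n) (linForm K n t) ⊓
      Proj.basicOpen (stdGrading K n) (linForm K n t') := by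
  have hι := Proj.opensRange_awayι (stdGrading K n) _ (linForm_mem K n t) one_pos
  have h1 : Proj.awayι (stdGrading K n) _ (linForm_mem K n t) one_pos ⁻¹ᵁ
      (Proj (stdGrading K n)).basicOpen (linSec K n t t') =
      Proj.awayι (stdGrading K n) _ (linForm_mem K n t) one_pos ⁻¹ᵁ
        Proj.basicOpen (stdGrading K n) (linForm K n t') := by
    have h2 := Scheme.basicOpen_appLE (Proj.awayι (stdGrading K n) _ (linForm_mem K n t) one_pos)
      ⊤ _ (le_preimage_awayι (stdGrading K n) (linForm_mem K n t) one_pos) (linSec K n t t')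
    rw [top_inf_eq] at h2
    rw [← h2, linSec, ← CommRingCat.comp_apply, awayι_appLE_awayToSection,
      Proj.awayι_preimage_basicOpen (stdGrading K n) (linForm_mem K n t) one_pos
        (linForm_mem K n t') one_pos]
    have : Away.isLocalizationElem (linForm_mem K n t) (linForm_mem K n t') =
        linFrac K n t t' := by
      apply HomogeneousLocalization.val_injective
      rw [linFrac, Away.isLocalizationElem, val_away_mk, val_away_mk, pow_one (linForm K n t')]
    rw [this]
    exact basicOpen_eq_of_affine (R := .of _) _
  have h3 := congrArg (fun V ↦ Proj.awayι (stdGrading K n) _ (linForm_mem K n t) one_pos ''ᵁ V) h1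
  simp only [Scheme.Hom.image_preimage_eq_opensRange_inf, hι] at h3
  rw [← h3]
  exact (inf_eq_right.2 (Scheme.basicOpen_le _ _)).symm

end LinCharts

section VeryAmple

open HomogeneousLocalization PreimagesQ Limits

variable {K : Type u} [Field K]

/-- A morphism into an affine open is determined by its effect on functions. -/
lemma toSpecΓ_appLE_fromSpec {T X : Scheme.{u}} {W : X.Opens} (hW : IsAffineOpen W) (f : T ⟶ X)
    (h : ⊤ ≤ f ⁻¹ᵁ W) : T.toSpecΓ ≫ Spec.map (f.appLE W ⊤ h) ≫ hW.fromSpec = f := by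
  have hr : Set.range f ⊆ Set.range W.ι := by
    rintro _ ⟨x, rfl⟩
    rw [Scheme.Opens.range_ι]
    exact h (TopologicalSpace.Opens.mem_top x)
  have h3 : W.topIso.inv = W.ι.appLE W ⊤ (by simp) := by
    simp [Scheme.Opens.topIso_inv]
    rfl
  have h4 : f.appLE W ⊤ h = W.topIso.inv ≫ (IsOpenImmersion.lift W.ι f hr).appTop := by
    rw [h3, Scheme.Hom.appTop_eq_appLE, Scheme.Hom.appLE_comp_appLE]
    simp only [IsOpenImmersion.lift_fac]
  rw [h4, Spec.map_comp, Category.assoc, ← Scheme.toSpecΓ_naturality_assoc]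
  refine .trans ?_ (IsOpenImmersion.lift_fac W.ι f hr)
  congr 1
  exact hW.toSpecΓ_fromSpec

lemma hom_ext_of_appLE_eq {T X : Scheme.{u}} {W : X.Opens} (hW : IsAffineOpen W) (f g : T ⟶ X)
    (h : ⊤ ≤ f ⁻¹ᵁ W) (h' : ⊤ ≤ g ⁻¹ᵁ W) (H : ∀ s, f.appLE W ⊤ h s = g.appLE W ⊤ h' s) :
    f = g := by
  have : f.appLE W ⊤ h = g.appLE W ⊤ h' := by ext s; exact H s
  rw [← toSpecΓ_appLE_fromSpec hW f h, this, toSpecΓ_appLE_fromSpec]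

/-- Affine charts `W t` of a projective `K`-scheme with generators `y t s` of the coordinate rings,
the quotients of linear forms, such that any `d` points lie in one of the charts. -/
structure GeneralCharts (X : Over (Spec (CommRingCat.of K))) (m d : ℕ) where
  W : Fin (m + 1) → X.left.Opens
  isAffineOpen_W : ∀ t, IsAffineOpen (W t)
  exists_forall_mem : ∀ p : Fin d → X.left, ∃ t, ∀ k, p k ∈ W t
  y : ∀ t, Fin (m + 1) → Γ(X.left, W t)
  y_self : ∀ t, y t t = 1
  cocycle : ∀ t t' i, X.left.presheaf.map (homOfLE inf_le_left : W t ⊓ W t' ⟶ W t).op (y t i) =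
    X.left.presheaf.map (homOfLE inf_le_left : W t ⊓ W t' ⟶ W t).op (y t t') *
    X.left.presheaf.map (homOfLE inf_le_right : W t ⊓ W t' ⟶ W t').op (y t' i)
  basicOpen_y : ∀ t t', X.left.basicOpen (y t t') = W t ⊓ W t'
  surjective : ∀ t, Function.Surjective (MvPolynomial.eval₂Hom (scalars X.hom (W t)) (y t))

lemma nonempty_generalCharts [CharZero K] {X : Over (Spec (CommRingCat.of K))} {n : ℕ}
    (j : X ⟶ projSpace K n) [IsClosedImmersion j.left] (d : ℕ) :
    Nonempty (GeneralCharts X (n * (d + 1)) d) := by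
  classical
  let j' : X.left ⟶ Proj (stdGrading K n) := j.left
  have hj : IsClosedImmersion j' := ‹_›
  have hj' : j' ≫ projStr K n = X.hom := Over.w j
  let O (t : ℕ) := Proj.basicOpen (stdGrading K n) (linForm K n t)
  have hO (t : ℕ) : IsAffineOpen (O t) :=
    Proj.isAffineOpen_basicOpen (stdGrading K n) _ (linForm_mem K n t) one_pos
  refine ⟨{ W := fun t ↦ j' ⁻¹ᵁ O t
            isAffineOpen_W := fun t ↦ (hO t).preimage j'
            exists_forall_mem := fun p ↦ ?_
            y := fun t s ↦ j'.app (O t) (linSec K n t s)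
            y_self := fun t ↦ by rw [linSec_self, map_one]
            cocycle := fun t t' i ↦ ?_
            basicOpen_y := fun t t' ↦ ?_
            surjective := fun t ↦ ?_ }⟩
  · by_contra! H
    have h1 : (Finset.univ : Finset (Fin (n * (d + 1) + 1))) ⊆ Finset.univ.biUnion fun k : Fin d ↦
        Finset.univ.filter fun t : Fin (n * (d + 1) + 1) ↦ j' (p k) ∉ O t := by
      intro t _
      obtain ⟨k, hk⟩ := H t
      simp only [Finset.mem_biUnion, Finset.mem_univ, Finset.mem_filter, true_and]
      exact ⟨k, hk⟩
    have h2 := (Finset.card_le_card h1).trans (Finset.card_biUnion_le_card_mul _ _ n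
      fun k _ ↦ card_linForm_vanishing_le (j' (p k)) _)
    -- There are `n * (d + 1) + 1` forms and at most `n * d` of them vanish at one of the points.
    simp only [Finset.card_univ, Fintype.card_fin] at h2
    nlinarith
  · have := congrArg (j'.appLE (O t ⊓ O t') (j' ⁻¹ᵁ (O t ⊓ O t')) le_rfl)
      (linSec_cocycle (K := K) (n := n) t t' i (W := O t ⊓ O t') inf_le_left inf_le_right)
    rw [map_mul] at this
    simp only [appLE_presheaf_map] at this
    simp only [Scheme.Hom.app_eq_appLE, presheaf_map_appLE]
    exact this
  · rw [← Scheme.Hom.preimage_basicOpen, basicOpen_linSec]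
    rfl
  · have h1 : MvPolynomial.eval₂Hom (scalars X.hom (j' ⁻¹ᵁ O t))
        (fun s : Fin (n * (d + 1) + 1) ↦ j'.app (O t) (linSec K n t s)) =
        (j'.app (O t)).hom.comp ((Proj.awayToSection (stdGrading K n) (linForm K n t)).hom.comp
        (MvPolynomial.eval₂Hom ((fromZeroRingHom (stdGrading K n) _).comp
      (algebraMap K (stdGrading K n 0))) fun s : Fin (n * (d + 1) + 1) ↦ linFrac K n t s)) := by
      refine MvPolynomial.ringHom_ext (fun c ↦ ?_) fun i ↦ ?_
      · simp only [RingHom.comp_apply, MvPolynomial.eval₂Hom_C]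
        rw [awayToSection_algebraMap (linForm_mem K n t) one_pos, Scheme.Hom.app_eq_appLE,
          appLE_scalars]
        simp only [hj']
      · simp only [RingHom.comp_apply, MvPolynomial.eval₂Hom_X']
        rfl
    rw [h1, RingHom.coe_comp, RingHom.coe_comp]
    refine Function.Surjective.comp (Scheme.Hom.app_surjective j' _ (hO t))
      ((bijective_awayToSection (stdGrading K n) (linForm_mem K n t) one_pos).2.comp
        (surjective_eval_linFrac (Nat.le_mul_of_pos_right n d.succ_pos) t))

end VeryAmple

/-! ### Products of affine charts -/

section ProductCharts

open PreimagesQ Limits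

variable {K : Type u} [Field K]

lemma toSpecΓ_SpecMap_injective {T : Scheme.{u}} {R : CommRingCat.{u}} {f g : R ⟶ Γ(T, ⊤)}
    (h : T.toSpecΓ ≫ Spec.map f = T.toSpecΓ ≫ Spec.map g) : f = g := by
  have := congr($(h).appTop)
  rw [Scheme.Hom.comp_appTop, Scheme.Hom.comp_appTop, Scheme.toSpecΓ_appTop,
    Scheme.ΓSpecIso_naturality, Scheme.ΓSpecIso_naturality, cancel_epi] at this
  exact this

lemma fromSpec_comp_eq_scalars {X : Scheme.{u}} (q : X ⟶ Spec (CommRingCat.of K)) {W : X.Opens}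
    (hW : IsAffineOpen W) :
    hW.fromSpec ≫ q = Spec.map (CommRingCat.ofHom (scalars q W)) := by
  have h := IsAffineOpen.SpecMap_appLE_fromSpec q (isAffineOpen_top _) hW (V := W) le_top
  rw [← h, IsAffineOpen.fromSpec_top, scalars, CommRingCat.ofHom_hom, Spec.map_comp,
    Scheme.isoSpec_Spec_inv]

variable {X P : Over (Spec (CommRingCat.of K))} {d : ℕ} (pr : Fin d → (P ⟶ X))

/-- The open subset of the points of the `d`-fold product all of whose coordinates lie in `W`. -/
noncomputable def prodOpen (W : X.left.Opens) : P.left.Opens := ⨅ k, (pr k).left ⁻¹ᵁ W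

lemma mem_prodOpen {W : X.left.Opens} {p : P.left} :
    p ∈ prodOpen pr W ↔ ∀ k, (pr k).left p ∈ W := by
  rw [prodOpen, ← SetLike.mem_coe, TopologicalSpace.Opens.coe_iInf]
  simp

lemma prodOpen_le (W : X.left.Opens) (k : Fin d) : prodOpen pr W ≤ (pr k).left ⁻¹ᵁ W :=
  iInf_le _ k

/-- If a subring `R'` of the functions on `U = W ^ d` contains the functions on the factors, then
the projections factor through `Spec R'`, and the universal property of the product provides an
inverse of `U ⟶ Spec R'`. With `R' = ⊤` this shows that `U` is affine, and for `U` affine it shows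
`R' = ⊤`. -/
lemma isAffineOpen_prodOpen_aux (hP : IsLimit (Fan.mk P pr)) {W : X.left.Opens}
    (hW : IsAffineOpen W) {U : P.left.Opens} (hU : U = prodOpen pr W) (R' : Subring Γ(U, ⊤))
    (hR : ∀ k s (h : ⊤ ≤ (U.ι ≫ (pr k).left) ⁻¹ᵁ W), (U.ι ≫ (pr k).left).appLE W ⊤ h s ∈ R')
    (hc : ∀ c, scalars (U.ι ≫ P.hom) ⊤ c ∈ R') : IsAffineOpen U ∧ R' = ⊤ := by
  have hq : ∀ k, ⊤ ≤ (U.ι ≫ (pr k).left) ⁻¹ᵁ W := fun k x _ ↦ (hU.le.trans (prodOpen_le pr W k)) x.2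
  have hw : ∀ k, (U.ι ≫ (pr k).left) ≫ X.hom = U.ι ≫ P.hom := fun k ↦ by
    rw [Category.assoc, Over.w]
  let a (k : Fin d) : Γ(X.left, W) →+* R' :=
    ((U.ι ≫ (pr k).left).appLE W ⊤ (hq k)).hom.codRestrict R' fun s ↦ hR k s _
  let c' : K →+* R' := (scalars (U.ι ≫ P.hom) ⊤).codRestrict R' hc
  let incl : CommRingCat.of R' ⟶ Γ(U, ⊤) := CommRingCat.ofHom R'.subtype
  let φ₀ (k : Fin d) : Spec (.of R') ⟶ X.left := Spec.map (CommRingCat.ofHom (a k)) ≫ hW.fromSpec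
  let ψ : U.toScheme ⟶ Spec (.of R') := U.toScheme.toSpecΓ ≫ Spec.map incl
  have hψ : ∀ k, ψ ≫ φ₀ k = U.ι ≫ (pr k).left := fun k ↦ by
    rw [← toSpecΓ_appLE_fromSpec hW (U.ι ≫ (pr k).left) (hq k)]
    simp only [ψ, φ₀, Category.assoc, ← Spec.map_comp_assoc]
    rfl
  have hφ₀ : ∀ k, φ₀ k ≫ X.hom = Spec.map (CommRingCat.ofHom c') := fun k ↦ by
    rw [Category.assoc, fromSpec_comp_eq_scalars, ← Spec.map_comp]
    congr 1
    ext x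
    change (U.ι ≫ (pr k).left).appLE W ⊤ (hq k) (scalars X.hom W x) =
      scalars (U.ι ≫ P.hom) ⊤ x
    rw [appLE_scalars]
    simp only [hw]
  let φ₁ (k : Fin d) : Over.mk (Spec.map (CommRingCat.ofHom c')) ⟶ X :=
    Over.homMk (φ₀ k) (hφ₀ k)
  let φ : Over.mk (Spec.map (CommRingCat.ofHom c')) ⟶ P := Fan.IsLimit.lift hP φ₁
  have hφ : ∀ k, φ.left ≫ (pr k).left = φ₀ k := fun k ↦
    congrArg (fun g ↦ CommaMorphism.left g) (Fan.IsLimit.fac hP φ₁ k)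
  have hψφ : ψ ≫ φ.left = U.ι := by
    have hs : ψ ≫ Spec.map (CommRingCat.ofHom c') = U.ι ≫ P.hom := by
      rw [← toSpecΓ_scalars (U.ι ≫ P.hom)]
      simp only [ψ, Category.assoc, ← Spec.map_comp]
      rfl
    let ψ' : Over.mk (U.ι ≫ P.hom) ⟶ Over.mk (Spec.map (CommRingCat.ofHom c')) := Over.homMk ψ hs
    let ι' : Over.mk (U.ι ≫ P.hom) ⟶ P := Over.homMk U.ι
    have : ψ' ≫ φ = ι' := by
      refine Fan.IsLimit.hom_ext hP _ _ fun k ↦ ?_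
      ext1
      change (ψ ≫ φ.left) ≫ (pr k).left = U.ι ≫ (pr k).left
      rw [Category.assoc, hφ, hψ]
    exact congr(CommaMorphism.left $this)
  have hr : Set.range φ.left ⊆ Set.range U.ι := by
    rintro _ ⟨x, rfl⟩
    rw [Scheme.Opens.range_ι]
    refine hU.ge <| (mem_prodOpen pr).2 fun k ↦ ?_
    rw [← Scheme.Hom.comp_apply, hφ, Scheme.Hom.comp_apply, ← SetLike.mem_coe, ← hW.range_fromSpec]
    exact ⟨_, rfl⟩
  let φ' : Spec (.of R') ⟶ U.toScheme := IsOpenImmersion.lift U.ι φ.left hr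
  have h1 : ψ ≫ φ' = 𝟙 _ := by
    rw [← cancel_mono U.ι, Category.assoc, IsOpenImmersion.lift_fac, hψφ, Category.id_comp]
  have h2 : φ' ≫ ψ = 𝟙 _ := by
    obtain ⟨α, hα⟩ := Spec.map_surjective (φ' ≫ ψ)
    have h3 : ψ ≫ Spec.map α = ψ := by rw [hα, ← Category.assoc, h1, Category.id_comp]
    simp only [ψ, Category.assoc, ← Spec.map_comp] at h3
    have h4 := toSpecΓ_SpecMap_injective h3
    have h5 : α = 𝟙 _ := by
      ext x
      exact congr($h4 x)
    rw [← hα, h5, Spec.map_id]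
  have : IsIso ψ := ⟨φ', h1, h2⟩
  refine ⟨.of_isIso ψ, ?_⟩
  have h6 : ψ.appTop = (Scheme.ΓSpecIso (.of R')).hom ≫ incl := by
    rw [Scheme.Hom.comp_appTop, Scheme.toSpecΓ_appTop, Scheme.ΓSpecIso_naturality]
  have h7 : IsIso incl := by
    have : IsIso ψ.appTop := inferInstanceAs (IsIso (ψ.app ⊤))
    rw [← Iso.inv_comp_eq] at h6
    rw [← h6]
    exact IsIso.comp_isIso
  have h8 := (ConcreteCategory.bijective_of_isIso incl).2
  rw [eq_top_iff]
  intro x _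
  obtain ⟨y, rfl⟩ := h8 x
  exact y.2

lemma bijective_ι_appLE {X : Scheme.{u}} (U : X.Opens) :
    Function.Bijective (U.ι.appLE U ⊤ (by simp)) :=
  ConcreteCategory.bijective_of_isIso _

lemma isAffineOpen_prodOpen (hP : IsLimit (Fan.mk P pr)) {W : X.left.Opens}
    (hW : IsAffineOpen W) : IsAffineOpen (prodOpen pr W) :=
  (isAffineOpen_prodOpen_aux pr hP hW rfl ⊤ (fun _ _ _ ↦ trivial) fun _ ↦ trivial).1

/-- The functions on a product of affine opens are generated by the functions on the factors. -/
lemma subring_prodOpen_eq_top (hP : IsLimit (Fan.mk P pr)) {W : X.left.Opens}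
    (hW : IsAffineOpen W) (R' : Subring Γ(P.left, prodOpen pr W))
    (hR : ∀ k s, (pr k).left.appLE W (prodOpen pr W) (prodOpen_le pr W k) s ∈ R')
    (hc : ∀ c, scalars P.hom (prodOpen pr W) c ∈ R') : R' = ⊤ := by
  have hle : ⊤ ≤ (prodOpen pr W).ι ⁻¹ᵁ prodOpen pr W := by simp
  have h := (isAffineOpen_prodOpen_aux pr hP hW rfl
    (R'.map ((prodOpen pr W).ι.appLE (prodOpen pr W) ⊤ hle).hom)
    (fun k s h ↦ ⟨_, hR k s, ?_⟩) fun c ↦ ⟨_, hc c, ?_⟩).2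
  · rw [eq_top_iff]
    intro x _
    have hx : (prodOpen pr W).ι.appLE (prodOpen pr W) ⊤ hle x ∈
      R'.map ((prodOpen pr W).ι.appLE (prodOpen pr W) ⊤ hle).hom := by rw [h]; trivial
    obtain ⟨y, hy, hyx⟩ := hx
    rwa [← (bijective_ι_appLE (prodOpen pr W)).1 hyx]
  · exact appLE_appLE _ _ hle _ s
  · exact appLE_scalars _ _ _ _ _ c

end ProductCharts

/-! ### The symmetrised Segre embedding -/

section Chow

open PreimagesQ Limits

variable {K : Type u} [Field K]

lemma appLE_basicOpen {X Y : Scheme.{u}} (f : X ⟶ Y) {V : Y.Opens} {W : X.Opens}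
    (h : W ≤ f ⁻¹ᵁ V) (s : Γ(Y, V)) (x : X) (hx : x ∈ W) :
    x ∈ X.basicOpen (f.appLE V W h s) ↔ f x ∈ Y.basicOpen s := by
  rw [Scheme.basicOpen_appLE]
  exact ⟨fun h ↦ h.2, fun h ↦ ⟨hx, h⟩⟩

lemma mem_basicOpen_prod {ι : Type*} {X : Scheme.{u}} {V : X.Opens} (x : X) (hx : x ∈ V)
    (s : Finset ι) (f : ι → Γ(X, V)) :
    x ∈ X.basicOpen (∏ i ∈ s, f i) ↔ ∀ i ∈ s, x ∈ X.basicOpen (f i) := by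
  classical
  induction s using Finset.induction_on with
  | empty => simp [Scheme.basicOpen_of_isUnit _ isUnit_one, hx]
  | insert a s ha ih =>
    rw [Finset.prod_insert ha, Scheme.basicOpen_mul, Finset.forall_mem_insert, ← ih]
    exact Iff.rfl

/-- Two morphisms that agree on the functions `s t i` have the same composite with the morphism to
projective space. -/
lemma ProjCharts.comp_hom_eq {P : Over (Spec (CommRingCat.of K))} {n : ℕ} {T : Type*}
    (D : ProjCharts P n T) (g : P.left ⟶ P.left) (hg : g ≫ P.hom = P.hom)
    (hU : ∀ t, D.U t ≤ g ⁻¹ᵁ D.U t)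
    (hs : ∀ t i, g.appLE (D.U t) (D.U t) (hU t) (D.s t i) = D.s t i) : g ≫ D.hom = D.hom := by
  let 𝒰 := P.left.openCoverOfIsOpenCover D.U D.iSup_U
  have key : ∀ t, (D.U t).ι ≫ g ≫ D.hom = (D.U t).ι ≫ D.hom := by
    intro t
    have hle : ⊤ ≤ (D.U t).ι ⁻¹ᵁ D.U t := D.le_preimage_ι t
    have h : ⊤ ≤ ((D.U t).ι ≫ g) ⁻¹ᵁ D.U t := fun x _ ↦ hU t x.2
    have hr : Set.range ((D.U t).ι ≫ g) ⊆ Set.range (D.U t).ι := by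
      rintro _ ⟨x, rfl⟩
      rw [Scheme.Opens.range_ι]
      exact h (TopologicalSpace.Opens.mem_top x)
    have h1 : IsOpenImmersion.lift (D.U t).ι ((D.U t).ι ≫ g) hr ≫ (D.U t).ι = (D.U t).ι ≫ g :=
      IsOpenImmersion.lift_fac _ _ _
    have h2 : ((D.U t).ι ≫ g) ≫ D.hom = D.chart t ((D.U t).ι ≫ g) h := by
      have := D.comp_chart (IsOpenImmersion.lift (D.U t).ι ((D.U t).ι ≫ g) hr) t (D.U t).ι hle
      simp only [h1] at this
      rw [← this, ← D.ι_hom, ← Category.assoc, h1]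
    have h3 : D.eval t ((D.U t).ι ≫ g) h = D.eval t (D.U t).ι hle := by
      refine MvPolynomial.ringHom_ext (fun c ↦ ?_) fun i ↦ ?_
      · simp only [eval, MvPolynomial.eval₂Hom_C, Category.assoc, hg]
      · simp only [eval, MvPolynomial.eval₂Hom_X']
        rw [← appLE_appLE (D.U t).ι g hle (hU t), hs]
    rw [← Category.assoc, h2, D.ι_hom]
    simp only [chart, h3]
  exact 𝒰.hom_ext _ _ key

variable {X P : Over (Spec (CommRingCat.of K))} {d : ℕ} {pr : Fin d → (P ⟶ X)}

/-- The permutation `σ` of the coordinates of the product, whose `k`-th coordinate is the `σ k`-th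
projection. -/
noncomputable def prodPerm (hP : IsLimit (Fan.mk P pr)) (σ : Equiv.Perm (Fin d)) : P ⟶ P :=
  Fan.IsLimit.lift hP fun k ↦ pr (σ k)

lemma prodPerm_pr (hP : IsLimit (Fan.mk P pr)) (σ : Equiv.Perm (Fin d)) (k : Fin d) :
    prodPerm hP σ ≫ pr k = pr (σ k) :=
  Fan.IsLimit.fac hP (fun k ↦ pr (σ k)) k

lemma prodPerm_comp (hP : IsLimit (Fan.mk P pr)) (σ τ : Equiv.Perm (Fin d)) :
    prodPerm hP σ ≫ prodPerm hP τ = prodPerm hP (σ * τ) := by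
  refine Fan.IsLimit.hom_ext hP _ _ fun k ↦ ?_
  change (prodPerm hP σ ≫ prodPerm hP τ) ≫ pr k = prodPerm hP (σ * τ) ≫ pr k
  rw [Category.assoc, prodPerm_pr, prodPerm_pr, prodPerm_pr, Equiv.Perm.mul_apply]

lemma prodPerm_one (hP : IsLimit (Fan.mk P pr)) : prodPerm hP 1 = 𝟙 P := by
  refine Fan.IsLimit.hom_ext hP _ _ fun k ↦ ?_
  change prodPerm hP 1 ≫ pr k = 𝟙 P ≫ pr k
  rw [prodPerm_pr, Category.id_comp, Equiv.Perm.one_apply]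

lemma prodPerm_left_pr (hP : IsLimit (Fan.mk P pr)) (σ : Equiv.Perm (Fin d)) (k : Fin d) :
    (prodPerm hP σ).left ≫ (pr k).left = (pr (σ k)).left := by
  rw [← prodPerm_pr hP σ k]; rfl

lemma prodOpen_le_preimage_prodPerm (hP : IsLimit (Fan.mk P pr)) (σ : Equiv.Perm (Fin d))
    (W : X.left.Opens) : prodOpen pr W ≤ (prodPerm hP σ).left ⁻¹ᵁ prodOpen pr W := by
  intro x hx
  refine (mem_prodOpen pr).2 fun k ↦ ?_
  rw [← Scheme.Hom.comp_apply, prodPerm_left_pr]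
  exact (mem_prodOpen pr).1 hx (σ k)

lemma prodPerm_appLE (hP : IsLimit (Fan.mk P pr)) (σ : Equiv.Perm (Fin d)) (k : Fin d)
    (W : X.left.Opens) (s : Γ(X.left, W)) :
    (prodPerm hP σ).left.appLE _ _ (prodOpen_le_preimage_prodPerm hP σ W)
      ((pr k).left.appLE W _ (prodOpen_le pr W k) s) =
      (pr (σ k)).left.appLE W _ (prodOpen_le pr W (σ k)) s := by
  rw [appLE_appLE]
  simp only [prodPerm_left_pr]

namespace GeneralCharts

variable {m : ℕ} (G : GeneralCharts X m d) (pr)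

/-- The average over all permutations of the product of the functions `y t (I k)` on the
factors. -/
noncomputable def symFun (t : Fin (m + 1)) (I : Fin d → Fin (m + 1)) :
    Γ(P.left, prodOpen pr (G.W t)) :=
  scalars P.hom _ (d.factorial : K)⁻¹ * ∑ σ : Equiv.Perm (Fin d),
    ∏ k, (pr (σ k)).left.appLE (G.W t) _ (prodOpen_le pr (G.W t) (σ k)) (G.y t (I k))

/-- For a constant multi-index the average is a single product: this is the coordinate that serves
as the denominator on a chart. -/
lemma symFun_const [CharZero K] (t t' : Fin (m + 1)) :
    G.symFun pr t (fun _ ↦ t') =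
      ∏ k, (pr k).left.appLE (G.W t) _ (prodOpen_le pr (G.W t) k) (G.y t t') := by
  have h (σ : Equiv.Perm (Fin d)) :
      ∏ k, (pr (σ k)).left.appLE (G.W t) _ (prodOpen_le pr (G.W t) (σ k)) (G.y t t') =
      ∏ k, (pr k).left.appLE (G.W t) _ (prodOpen_le pr (G.W t) k) (G.y t t') :=
    Equiv.prod_comp σ fun k ↦ (pr k).left.appLE (G.W t) _ (prodOpen_le pr (G.W t) k) (G.y t t')
  rw [symFun]
  simp only [h]
  rw [Finset.sum_const, Finset.card_univ, Fintype.card_perm, Fintype.card_fin, nsmul_eq_mul,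
    ← mul_assoc, ← map_natCast (scalars P.hom _) d.factorial, ← map_mul,
    inv_mul_cancel₀ (Nat.cast_ne_zero.2 d.factorial_ne_zero), map_one, one_mul]

lemma prodPerm_symFun (hP : IsLimit (Fan.mk P pr)) (σ : Equiv.Perm (Fin d)) (t : Fin (m + 1))
    (I : Fin d → Fin (m + 1)) :
    (prodPerm hP σ).left.appLE _ _ (prodOpen_le_preimage_prodPerm hP σ (G.W t)) (G.symFun pr t I) =
      G.symFun pr t I := by
  rw [symFun, map_mul, appLE_scalars, map_sum]
  simp only [map_prod, prodPerm_appLE, Over.w]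
  congr 1
  exact Equiv.sum_comp (Equiv.mulLeft σ) fun τ ↦
    ∏ k, (pr (τ k)).left.appLE (G.W t) _ (prodOpen_le pr (G.W t) (τ k)) (G.y t (I k))

lemma symFun_cocycle [CharZero K] (t t' : Fin (m + 1)) (I : Fin d → Fin (m + 1)) :
    P.left.presheaf.map (homOfLE inf_le_left : prodOpen pr (G.W t) ⊓ prodOpen pr (G.W t') ⟶
      prodOpen pr (G.W t)).op (G.symFun pr t I) =
    P.left.presheaf.map (homOfLE inf_le_left : prodOpen pr (G.W t) ⊓ prodOpen pr (G.W t') ⟶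
      prodOpen pr (G.W t)).op (G.symFun pr t fun _ ↦ t') *
    P.left.presheaf.map (homOfLE inf_le_right : prodOpen pr (G.W t) ⊓ prodOpen pr (G.W t') ⟶
      prodOpen pr (G.W t')).op (G.symFun pr t' I) := by
  set O := prodOpen pr (G.W t) ⊓ prodOpen pr (G.W t')
  have hO (k : Fin d) : O ≤ (pr k).left ⁻¹ᵁ (G.W t ⊓ G.W t') :=
    le_inf (inf_le_left.trans (prodOpen_le pr _ k)) (inf_le_right.trans (prodOpen_le pr _ k))
  have h1 (k : Fin d) : O ≤ (pr k).left ⁻¹ᵁ G.W t := inf_le_left.trans (prodOpen_le pr _ k)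
  have h2 (k : Fin d) : O ≤ (pr k).left ⁻¹ᵁ G.W t' := inf_le_right.trans (prodOpen_le pr _ k)
  have hc (k : Fin d) (i : Fin (m + 1)) : (pr k).left.appLE _ O (h1 k) (G.y t i) =
      (pr k).left.appLE _ O (h1 k) (G.y t t') * (pr k).left.appLE _ O (h2 k) (G.y t' i) := by
    have := congrArg ((pr k).left.appLE _ O (hO k)) (G.cocycle t t' i)
    rw [map_mul] at this
    simpa only [appLE_presheaf_map] using this
  have hs {V : P.left.Opens} (i : O ⟶ V) (c : K) :
      P.left.presheaf.map i.op (scalars P.hom V c) = scalars P.hom O c :=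
    presheaf_map_appLE P.hom le_top i _
  rw [symFun_const, symFun, symFun]
  simp only [map_mul, map_sum, map_prod, presheaf_map_appLE, hs]
  rw [mul_left_comm]
  congr 1
  rw [Finset.mul_sum]
  refine Finset.sum_congr rfl fun σ _ ↦ ?_
  rw [← Equiv.prod_comp σ fun k ↦ (pr k).left.appLE (G.W t) O _ (G.y t t'),
    ← Finset.prod_mul_distrib]
  exact Finset.prod_congr rfl fun k _ ↦ hc _ _

/-- An enumeration of the multi-indices. -/
noncomputable def indexEquiv (m d : ℕ) :
    Fin ((m + 1) ^ d - 1 + 1) ≃ (Fin d → Fin (m + 1)) :=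
  (Fintype.equivFinOfCardEq (by
    rw [Fintype.card_fun, Fintype.card_fin, Fintype.card_fin,
      Nat.sub_add_cancel (Nat.one_le_pow _ _ m.succ_pos)])).symm

/-- The charts of the symmetrised Segre map of the `d`-fold product. -/
noncomputable def projCharts [CharZero K] :
    ProjCharts P ((m + 1) ^ d - 1) (Fin (m + 1)) where
  U t := prodOpen pr (G.W t)
  iSup_U := by
    rw [eq_top_iff]
    intro p _
    obtain ⟨t, ht⟩ := G.exists_forall_mem fun k ↦ (pr k).left p
    exact TopologicalSpace.Opens.mem_iSup.2 ⟨t, (mem_prodOpen pr).2 ht⟩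
  e t := (indexEquiv m d).symm fun _ ↦ t
  s t i := G.symFun pr t (indexEquiv m d i)
  s_self t := by
    rw [Equiv.apply_symm_apply, symFun_const]
    simp [G.y_self]
  cocycle t t' i := by
    rw [Equiv.apply_symm_apply]
    exact G.symFun_cocycle pr t t' _
  basicOpen_s t t' := by
    rw [Equiv.apply_symm_apply, symFun_const]
    ext x
    have h : x ∈ prodOpen pr (G.W t) → (x ∈ P.left.basicOpen
        (∏ k, (pr k).left.appLE (G.W t) _ (prodOpen_le pr (G.W t) k) (G.y t t')) ↔
        x ∈ prodOpen pr (G.W t) ⊓ prodOpen pr (G.W t')) := fun hx ↦ by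
      rw [mem_basicOpen_prod x hx]
      simp only [Finset.mem_univ, true_imp_iff, appLE_basicOpen _ _ _ _ hx, G.basicOpen_y]
      exact ⟨fun h ↦ ⟨hx, (mem_prodOpen pr).2 fun k ↦ (h k).2⟩,
        fun h k ↦ ⟨(mem_prodOpen pr).1 h.1 k, (mem_prodOpen pr).1 h.2 k⟩⟩
    exact ⟨fun hx ↦ (h (P.left.basicOpen_le _ hx)).1 hx, fun hx ↦ (h hx.1).2 hx⟩

lemma prodPerm_hom [CharZero K] (hP : IsLimit (Fan.mk P pr)) (σ : Equiv.Perm (Fin d)) :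
    (prodPerm hP σ).left ≫ (G.projCharts pr).hom = (G.projCharts pr).hom :=
  (G.projCharts pr).comp_hom_eq _ (Over.w _)
    (fun t ↦ prodOpen_le_preimage_prodPerm hP σ (G.W t)) fun t _ ↦ G.prodPerm_symFun pr hP σ t _

end GeneralCharts

end Chow

/-! ### Quotients by finite groups -/

section Quotient

open Limits

lemma hom_ext_of_forall_exists {Z Q : Scheme.{u}} {g g' : Z ⟶ Q}
    (h : ∀ z, ∃ V : Z.Opens, z ∈ V ∧ V.ι ≫ g = V.ι ≫ g') : g = g' := by
  choose V hz hV using h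
  have hc : ⨆ z, V z = ⊤ := eq_top_iff.2 fun z _ ↦ TopologicalSpace.Opens.mem_iSup.2 ⟨z, hz z⟩
  exact (Z.openCoverOfIsOpenCover V hc).hom_ext _ _ hV

/-- Surjective scheme-theoretically dominant morphisms are epimorphisms. -/
lemma eq_of_comp_eq_of_surjective {P Z Q : Scheme.{u}} (π : P ⟶ Z) [Surjective π]
    [IsSchemeTheoreticallyDominant π] [QuasiCompact π] {g g' : Z ⟶ Q} (h : π ≫ g = π ≫ g') :
    g = g' := by
  have hb : ∀ z, g z = g' z := fun z ↦ by
    obtain ⟨x, rfl⟩ := π.surjective z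
    rw [← Scheme.Hom.comp_apply, h, Scheme.Hom.comp_apply]
  refine hom_ext_of_forall_exists fun z ↦ ?_
  obtain ⟨_, ⟨Q', hQ', rfl⟩, hz, -⟩ :=
    Q.isBasis_affineOpens.exists_subset_of_mem_open (Set.mem_univ (g z)) isOpen_univ
  have hV : g ⁻¹ᵁ Q' ≤ g' ⁻¹ᵁ Q' := fun y hy ↦ by
    change g' y ∈ Q'
    rw [← hb y]
    exact hy
  refine ⟨g ⁻¹ᵁ Q', hz, ?_⟩
  have hle : ⊤ ≤ (g ⁻¹ᵁ Q').ι ⁻¹ᵁ (g ⁻¹ᵁ Q') := by simp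
  refine hom_ext_of_appLE_eq hQ' _ _ (fun y _ ↦ y.2) (fun y _ ↦ hV y.2) fun s ↦ ?_
  rw [← appLE_appLE _ _ hle le_rfl, ← appLE_appLE _ _ hle hV]
  congr 1
  apply π.app_injective
  rw [Scheme.Hom.app_eq_appLE, appLE_appLE, appLE_appLE]
  simp only [h]

/-- `π` is the quotient of `P` by the endomorphisms `act σ`: its fibres are the orbits, and on
arbitrarily small neighbourhoods of the points of `Z` all invariant functions come from `Z`. -/
structure IsOrbitQuotient {G : Type*} {P Z : Scheme.{u}} (act : G → (P ⟶ P)) (π : P ⟶ Z) :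
    Prop where
  comp : ∀ σ, act σ ≫ π = π
  surjective : Surjective π
  dominant : IsSchemeTheoreticallyDominant π
  isIntegralHom : IsIntegralHom π
  exists_act : ∀ x y, π x = π y → ∃ σ, act σ x = y
  exists_nhds : ∀ (O : Z.Opens), ∀ z ∈ O, ∃ V ≤ O, z ∈ V ∧
    ∀ s : Γ(P, π ⁻¹ᵁ V), (∀ σ (h : π ⁻¹ᵁ V ≤ act σ ⁻¹ᵁ (π ⁻¹ᵁ V)), (act σ).appLE _ _ h s = s) →
      ∃ b, π.app V b = s

/-- An invariant morphism descends to the quotient locally on the target, where it maps into an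
affine open subset and is given by invariant functions. -/
lemma IsOrbitQuotient.exists_local_desc {G : Type*} {P Z Q : Scheme.{u}} {act : G → (P ⟶ P)}
    {π : P ⟶ Z} (hπ : IsOrbitQuotient act π) (h : P ⟶ Q) (hh : ∀ σ, act σ ≫ h = h) (z : Z) :
    ∃ V : Z.Opens, z ∈ V ∧ ∃ g : V.toScheme ⟶ Q,
      π.resLE V (π ⁻¹ᵁ V) le_rfl ≫ g = (π ⁻¹ᵁ V).ι ≫ h := by
  have := hπ.surjective
  have := hπ.dominant
  have := hπ.isIntegralHom
  obtain ⟨x, rfl⟩ := π.surjective z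
  obtain ⟨_, ⟨Q', hQ', rfl⟩, hx, -⟩ :=
    Q.isBasis_affineOpens.exists_subset_of_mem_open (Set.mem_univ (h x)) isOpen_univ
  -- The complement of the image of the complement of `h ⁻¹ᵁ Q'`, an invariant open subset.
  let O : Z.Opens := ⟨(π '' (h ⁻¹ᵁ Q' : Set P)ᶜ)ᶜ,
    (π.isClosedMap _ (h ⁻¹ᵁ Q').isOpen.isClosed_compl).isOpen_compl⟩
  have hxO : π x ∈ O := by
    rintro ⟨y, hy, hyx⟩
    obtain ⟨σ, rfl⟩ := hπ.exists_act y x hyx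
    apply hy
    change h y ∈ Q'
    rw [← hh σ]
    exact hx
  obtain ⟨V, hVO, hxV, hV⟩ := hπ.exists_nhds O _ hxO
  have hle : π ⁻¹ᵁ V ≤ h ⁻¹ᵁ Q' := fun y hy ↦ by
    by_contra hy'
    exact hVO hy ⟨y, hy', rfl⟩
  have hinv : ∀ s : Γ(Q, Q'), h.appLE Q' (π ⁻¹ᵁ V) hle s ∈ (π.app V).hom.range := fun s ↦ by
    obtain ⟨b, hb⟩ := hV (h.appLE Q' (π ⁻¹ᵁ V) hle s) fun σ hσ ↦ by
      rw [appLE_appLE]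
      simp only [hh]
    exact ⟨b, hb⟩
  let ε := RingEquiv.ofBijective (π.app V).hom.rangeRestrict
    ⟨fun a b hab ↦ π.app_injective V (congrArg Subtype.val hab),
      (π.app V).hom.rangeRestrict_surjective⟩
  let β : Γ(Q, Q') ⟶ Γ(Z, V) := CommRingCat.ofHom
    (ε.symm.toRingHom.comp ((h.appLE Q' (π ⁻¹ᵁ V) hle).hom.codRestrict _ hinv))
  have hβ : β ≫ π.appLE V (π ⁻¹ᵁ V) le_rfl = h.appLE Q' (π ⁻¹ᵁ V) hle := by
    ext s
    rw [← Scheme.Hom.app_eq_appLE]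
    exact congrArg Subtype.val (ε.apply_symm_apply
      ((h.appLE Q' (π ⁻¹ᵁ V) hle).hom.codRestrict _ hinv s))
  refine ⟨V, hxV, V.toSpecΓ ≫ Spec.map β ≫ hQ'.fromSpec, ?_⟩
  rw [← Scheme.Opens.toSpecΓ_SpecMap_appLE_assoc, ← Spec.map_comp_assoc, hβ,
    Scheme.Opens.toSpecΓ_SpecMap_appLE_assoc, hQ'.toSpecΓ_fromSpec, Scheme.Hom.resLE_comp_ι]

/-- The universal property of the quotient. -/
lemma IsOrbitQuotient.exists_desc {G : Type*} {P Z Q : Scheme.{u}} {act : G → (P ⟶ P)}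
    {π : P ⟶ Z} (hπ : IsOrbitQuotient act π) (h : P ⟶ Q) (hh : ∀ σ, act σ ≫ h = h) :
    ∃ g : Z ⟶ Q, π ≫ g = h := by
  have := hπ.surjective
  have := hπ.dominant
  have := hπ.isIntegralHom
  choose V hzV g hg using hπ.exists_local_desc h hh
  have hc : ⨆ z, V z = ⊤ := eq_top_iff.2 fun z _ ↦ TopologicalSpace.Opens.mem_iSup.2 ⟨z, hzV z⟩
  let 𝒰 := Z.openCoverOfIsOpenCover V hc
  -- On a scheme over `P` mapping to `V z`, the local morphism is the restriction of `h`.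
  have hloc : ∀ {T : Scheme.{u}} (p : T ⟶ P) (z : Z) (q : T ⟶ (V z).toScheme),
      p ≫ π = q ≫ (V z).ι → q ≫ g z = p ≫ h := by
    intro T p z q hpq
    have hr : Set.range p ⊆ Set.range (π ⁻¹ᵁ V z).ι := by
      rintro _ ⟨x, rfl⟩
      rw [Scheme.Opens.range_ι]
      change (p ≫ π) x ∈ V z
      rw [hpq]
      exact (q x).2
    have h1 := IsOpenImmersion.lift_fac (π ⁻¹ᵁ V z).ι p hr
    have h2 : q = IsOpenImmersion.lift (π ⁻¹ᵁ V z).ι p hr ≫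
        π.resLE (V z) (π ⁻¹ᵁ V z) le_rfl := by
      rw [← cancel_mono (V z).ι, Category.assoc, Scheme.Hom.resLE_comp_ι, ← hpq, ← Category.assoc,
        h1]
    rw [h2, Category.assoc, hg, ← Category.assoc, h1]
  -- The local morphisms agree on overlaps because they do so after the flat base change of `π`.
  have key : ∀ z z' : Z, pullback.fst (V z).ι (V z').ι ≫ g z =
      pullback.snd (V z).ι (V z').ι ≫ g z' := by
    intro z z'
    let j := pullback.fst (V z).ι (V z').ι ≫ (V z).ι
    apply eq_of_comp_eq_of_surjective (pullback.snd π j)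
    rw [← Category.assoc, ← Category.assoc, hloc (pullback.fst π j), hloc (pullback.fst π j)]
    · rw [pullback.condition, Category.assoc, ← pullback.condition (f := (V z).ι)]
    · rw [pullback.condition, Category.assoc]
  let r := 𝒰.glueMorphisms g key
  have hr : ∀ z, (V z).ι ≫ r = g z := fun z ↦ 𝒰.ι_glueMorphisms g key z
  refine ⟨r, hom_ext_of_forall_exists fun x ↦ ⟨π ⁻¹ᵁ V (π x), hzV _, ?_⟩⟩
  rw [← hg, ← hr, Scheme.Hom.resLE_comp_ι_assoc]

end Quotient

section QuotientCriterion

open Limits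

/-- Integrality and transitivity on the primes of a fibre, for a finite group acting by ring
endomorphisms with invariants the image of `φ`. -/
lemma isIntegral_and_exists_comap_eq {G A B : Type*} [Group G] [Finite G] [CommRing A]
    [CommRing B] (φ : A →+* B) (ρ : G → B →+* B) (h1 : ρ 1 = RingHom.id B)
    (hmul : ∀ σ τ, ρ (σ * τ) = (ρ σ).comp (ρ τ)) (hφ : ∀ σ a, ρ σ (φ a) = φ a)
    (hinv : ∀ b, (∀ σ, ρ σ b = b) → ∃ a, φ a = b) :
    φ.IsIntegral ∧ ∀ p q : Ideal B, p.IsPrime → q.IsPrime → p.comap φ = q.comap φ →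
      ∃ σ, q = p.comap (ρ σ) := by
  let : Algebra A B := φ.toAlgebra
  let : MulSemiringAction G B :=
    { smul := fun σ b ↦ ρ σ b
      one_smul := fun b ↦ congr($h1 b)
      mul_smul := fun σ τ b ↦ congr($(hmul σ τ) b)
      smul_zero := fun σ ↦ map_zero _
      smul_add := fun σ ↦ map_add _
      smul_one := fun σ ↦ map_one _
      smul_mul := fun σ ↦ map_mul _ }
  have hs : ∀ (σ : G) (b : B), σ • b = ρ σ b := fun _ _ ↦ rfl
  have : Algebra.IsInvariant A B G := ⟨hinv⟩
  have : SMulCommClass G A B := ⟨fun σ a b ↦ by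
    rw [Algebra.smul_def, Algebra.smul_def, hs, hs, map_mul]
    exact congrArg (· * _) (hφ σ a)⟩
  refine ⟨(Algebra.IsInvariant.isIntegral A B G).isIntegral, fun p q hp hq hpq ↦ ?_⟩
  obtain ⟨σ, rfl⟩ := Algebra.IsInvariant.exists_smul_of_under_eq A B G p q hpq
  refine ⟨σ⁻¹, ?_⟩
  ext b
  rw [Ideal.mem_comap, ← hs, ← Ideal.smul_mem_pointwise_smul_iff (a := σ) (x := σ⁻¹ • b),
    smul_inv_smul]

/-- Invariants commute with localization at an invariant element. -/
lemma exists_invariant_of_isLocalization {G B B' : Type*} [Finite G] [CommRing B] [CommRing B']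
    [Algebra B B'] (a : B) [IsLocalization.Away a B'] (ρ : G → B →+* B) (ρ' : G → B' →+* B')
    (hρ : ∀ σ b, ρ' σ (algebraMap B B' b) = algebraMap B B' (ρ σ b)) (ha : ∀ σ, ρ σ a = a)
    (s : B') (hs : ∀ σ, ρ' σ s = s) :
    ∃ (n : ℕ) (b : B), (∀ σ, ρ σ b = b) ∧ s * algebraMap B B' a ^ n = algebraMap B B' b := by
  have := Fintype.ofFinite G
  obtain ⟨n, b, hb⟩ := IsLocalization.Away.surj a s
  have h1 : ∀ σ, ∃ k : ℕ, a ^ k * ρ σ b = a ^ k * b := fun σ ↦ by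
    have h2 : algebraMap B B' (ρ σ b) = algebraMap B B' b := by
      rw [← hρ, ← hb, map_mul, map_pow, hs, hρ, ha]
    obtain ⟨⟨_, k, rfl⟩, hk⟩ := (IsLocalization.eq_iff_exists (Submonoid.powers a) B').1 h2
    exact ⟨k, hk⟩
  choose k hk using h1
  refine ⟨n + ∑ σ, k σ, a ^ (∑ σ, k σ) * b, fun σ ↦ ?_, ?_⟩
  · obtain ⟨l, hl⟩ := Nat.exists_eq_add_of_le
      (Finset.single_le_sum (fun _ _ ↦ Nat.zero_le _) (Finset.mem_univ σ) : k σ ≤ ∑ σ, k σ)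
    rw [map_mul, map_pow, ha, hl, add_comm, pow_add, mul_assoc, hk, mul_assoc]
  · rw [map_mul, map_pow, ← hb]
    ring

lemma fromSpec_SpecMap_appLE {X Y : Scheme.{u}} (f : X ⟶ Y) {V : X.Opens} {U : Y.Opens}
    (hU : IsAffineOpen U) (hV : IsAffineOpen V) (i : V ≤ f ⁻¹ᵁ U) (p : Spec Γ(X, V)) :
    hU.fromSpec (Spec.map (f.appLE U V i) p) = f (hV.fromSpec p) := by
  rw [← Scheme.Hom.comp_apply, IsAffineOpen.SpecMap_appLE_fromSpec f hU hV, Scheme.Hom.comp_apply]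

/-- A morphism is the quotient by a finite group if it is so on an affine cover of the target. -/
lemma isOrbitQuotient_of_cover {G : Type*} [Group G] [Finite G] {P Z : Scheme.{u}}
    (act : G → (P ⟶ P)) (hone : act 1 = 𝟙 P) (hmul : ∀ σ τ, act σ ≫ act τ = act (σ * τ))
    (π : P ⟶ Z) [QuasiCompact π] [IsSchemeTheoreticallyDominant π] (hc : ∀ σ, act σ ≫ π = π)
    {T : Type*} (V : T → Z.Opens) (hV : ⨆ t, V t = ⊤) (hVa : ∀ t, IsAffineOpen (V t))
    (hUa : ∀ t, IsAffineOpen (π ⁻¹ᵁ V t))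
    (hinv : ∀ t (s : Γ(P, π ⁻¹ᵁ V t)), (∀ σ (h : π ⁻¹ᵁ V t ≤ act σ ⁻¹ᵁ (π ⁻¹ᵁ V t)),
      (act σ).appLE _ _ h s = s) → ∃ b, π.app (V t) b = s) :
    IsOrbitQuotient act π := by
  have hle : ∀ (V : Z.Opens) σ, π ⁻¹ᵁ V ≤ act σ ⁻¹ᵁ (π ⁻¹ᵁ V) := fun V σ ↦ by
    rw [← Scheme.Hom.comp_preimage, hc]
  let ρ (V : Z.Opens) (σ : G) : Γ(P, π ⁻¹ᵁ V) →+* Γ(P, π ⁻¹ᵁ V) :=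
    ((act σ).appLE _ _ (hle V σ)).hom
  have hρ1 : ∀ V, ρ V 1 = RingHom.id _ := fun V ↦ by
    ext s
    change (act 1).appLE _ _ (hle V 1) s = s
    simp only [hone]
    exact congr($(P.presheaf.map_id (.op (π ⁻¹ᵁ V))) s)
  have hρmul : ∀ V σ τ, ρ V (σ * τ) = (ρ V σ).comp (ρ V τ) := fun V σ τ ↦ by
    ext s
    change (act (σ * τ)).appLE _ _ (hle V _) s =
      (act σ).appLE _ _ (hle V σ) ((act τ).appLE _ _ (hle V τ) s)
    rw [appLE_appLE]
    simp only [hmul]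
  have hρπ : ∀ V σ a, ρ V σ (π.app V a) = π.app V a := fun V σ a ↦ by
    change (act σ).appLE _ _ (hle V σ) (π.app V a) = π.app V a
    rw [Scheme.Hom.app_eq_appLE, appLE_appLE]
    simp only [hc]
  have hmain t := isIntegral_and_exists_comap_eq (π.app (V t)).hom (ρ (V t)) (hρ1 _) (hρmul _)
    (hρπ _) fun s hs ↦ hinv t s fun σ _ ↦ hs σ
  have hint : IsIntegralHom π := by
    refine (IsIntegralHom.hasAffineProperty.iff_of_iSup_eq_top
      (fun t ↦ (⟨V t, hVa t⟩ : Z.affineOpens)) hV).2 fun t ↦ ⟨hUa t, ?_⟩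
    change RingHom.IsIntegral ((π ∣_ V t).app ⊤).hom
    rw [← Scheme.Hom.resLE_eq_morphismRestrict, Scheme.Hom.resLE_app_top,
      ← Scheme.Hom.app_eq_appLE]
    refine RingHom.IsIntegral.trans _ _ (RingHom.isIntegral_of_surjective _
      (ConcreteCategory.bijective_of_isIso (V t).topIso.hom).2) ?_
    exact RingHom.IsIntegral.trans _ _ (hmain t).1 (RingHom.isIntegral_of_surjective _
      (ConcreteCategory.bijective_of_isIso (π ⁻¹ᵁ V t).topIso.inv).2)
  have hsurj : Surjective π := by
    refine ⟨Set.range_eq_univ.1 ?_⟩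
    rw [← π.isClosedMap.isClosed_range.closure_eq, π.denseRange.closure_eq]
  refine ⟨hc, hsurj, ‹_›, hint, fun x y hxy ↦ ?_, fun O z hz ↦ ?_⟩
  · obtain ⟨t, ht⟩ := TopologicalSpace.Opens.mem_iSup.1
      (hV.ge (TopologicalSpace.Opens.mem_top (π x)))
    have hx : x ∈ π ⁻¹ᵁ V t := ht
    have hy : y ∈ π ⁻¹ᵁ V t := by change π y ∈ V t; rwa [← hxy]
    let p : Spec Γ(P, π ⁻¹ᵁ V t) := (hUa t).primeIdealOf ⟨x, hx⟩
    let q : Spec Γ(P, π ⁻¹ᵁ V t) := (hUa t).primeIdealOf ⟨y, hy⟩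
    have hp : (hUa t).fromSpec p = x := (hUa t).fromSpec_primeIdealOf ⟨x, hx⟩
    have hq : (hUa t).fromSpec q = y := (hUa t).fromSpec_primeIdealOf ⟨y, hy⟩
    have hpq : Spec.map (π.appLE (V t) (π ⁻¹ᵁ V t) le_rfl) p =
        Spec.map (π.appLE (V t) (π ⁻¹ᵁ V t) le_rfl) q := by
      apply (hVa t).fromSpec.isOpenEmbedding.injective
      rw [fromSpec_SpecMap_appLE π (hVa t) (hUa t), fromSpec_SpecMap_appLE π (hVa t) (hUa t), hp,
        hq, hxy]
    rw [← Scheme.Hom.app_eq_appLE] at hpq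
    obtain ⟨σ, hσ⟩ := (hmain t).2 p.asIdeal q.asIdeal p.2 q.2
      (congrArg PrimeSpectrum.asIdeal hpq)
    refine ⟨σ, ?_⟩
    have hq' : q = Spec.map ((act σ).appLE _ _ (hle (V t) σ)) p := PrimeSpectrum.ext hσ
    rw [← hp, ← hq, hq', fromSpec_SpecMap_appLE (act σ) (hUa t) (hUa t)]
  · obtain ⟨t, ht⟩ := TopologicalSpace.Opens.mem_iSup.1
      (hV.ge (TopologicalSpace.Opens.mem_top z))
    obtain ⟨a, haO, hza⟩ := (hVa t).exists_basicOpen_le ⟨z, hz⟩ ht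
    refine ⟨Z.basicOpen a, haO, hza, fun s hs ↦ ?_⟩
    have hD : π ⁻¹ᵁ Z.basicOpen a = P.basicOpen (π.app (V t) a) := Scheme.Hom.preimage_basicOpen ..
    let i : π ⁻¹ᵁ Z.basicOpen a ⟶ π ⁻¹ᵁ V t := homOfLE (π.preimage_mono (Z.basicOpen_le a))
    let := (P.presheaf.map i.op).hom.toAlgebra
    have : IsLocalization.Away (π.app (V t) a) Γ(P, π ⁻¹ᵁ Z.basicOpen a) :=
      (hUa t).isLocalization_of_eq_basicOpen _ i hD
    have hcomm : ∀ σ b, ρ (Z.basicOpen a) σ (algebraMap _ Γ(P, π ⁻¹ᵁ Z.basicOpen a) b) =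
        algebraMap _ Γ(P, π ⁻¹ᵁ Z.basicOpen a) (ρ (V t) σ b) := fun σ b ↦ by
      change (act σ).appLE _ _ (hle (Z.basicOpen a) σ) (P.presheaf.map i.op b) =
        P.presheaf.map i.op ((act σ).appLE _ _ (hle (V t) σ) b)
      rw [appLE_presheaf_map, presheaf_map_appLE]
    obtain ⟨n, b, hb, hsb⟩ := exists_invariant_of_isLocalization (π.app (V t) a) (ρ (V t))
      (ρ (Z.basicOpen a)) hcomm (fun σ ↦ hρπ _ σ a) s fun σ ↦ hs σ _
    obtain ⟨c, rfl⟩ := hinv t b fun σ _ ↦ hb σ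
    have hres : ∀ c, algebraMap _ Γ(P, π ⁻¹ᵁ Z.basicOpen a) (π.app (V t) c) =
        π.app (Z.basicOpen a) (Z.presheaf.map (homOfLE (Z.basicOpen_le a)).op c) := fun c ↦
      congr($(π.naturality (homOfLE (Z.basicOpen_le a)).op) c).symm
    have hu : IsUnit (Z.presheaf.map (homOfLE (Z.basicOpen_le a)).op a) :=
      RingedSpace.isUnit_res_basicOpen _ a
    obtain ⟨v, hv⟩ := hu
    refine ⟨Z.presheaf.map (homOfLE (Z.basicOpen_le a)).op c * ((v⁻¹ ^ n : _ˣ) : Γ(Z, _)), ?_⟩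
    rw [map_mul, ← hres c, ← hsb, hres, ← hv, mul_assoc, ← map_pow, ← map_mul,
      ← Units.val_pow_eq_pow_val, ← Units.val_mul, inv_pow, mul_inv_cancel, Units.val_one, map_one,
      mul_one]

end QuotientCriterion

/-! ### Properness -/

section Proper

open PreimagesQ Limits

/-- A multiplicative property of morphisms that is stable under base change passes to finite
products over a base. -/
lemma isClosedUnderFiniteProducts_overObj {C : Type*} [Category* C] [HasPullbacks C]
    (W : MorphismProperty C) [W.IsMultiplicative] [W.IsStableUnderBaseChange] (S : C)
    [HasFiniteProducts (Over S)] :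
    (W.overObj (X := S)).IsClosedUnderFiniteProducts := by
  have : (W.overObj (X := S)).IsClosedUnderLimitsOfShape (Discrete.{0} PEmpty) := by
    refine ⟨fun A ⟨p⟩ ↦ ?_⟩
    have hA : IsTerminal A :=
      (IsLimit.equivOfNatIsoOfIso p.diag.uniqueFromEmpty _ _
        (by exact Cone.ext (Iso.refl _) (by rintro ⟨⟨⟩⟩))).1 p.isLimit
    have e : A ≅ Over.mk (𝟙 S) := hA.uniqueUpToIso Over.mkIdTerminal
    have h1 : A.hom = e.hom.left := by
      rw [← Over.w e.hom]
      exact Category.comp_id _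
    change W A.hom
    have : IsIso e.hom.left := inferInstanceAs (IsIso ((Over.forget S).map e.hom))
    rw [h1]
    exact W.of_isIso _
  have : (W.overObj (X := S)).IsClosedUnderBinaryProducts := by
    refine ⟨fun A ⟨p, hp⟩ ↦ ?_⟩
    let X₁ := p.diag.obj ⟨.left⟩
    let X₂ := p.diag.obj ⟨.right⟩
    let e : A ≅ X₁ ⨯ X₂ := IsLimit.conePointsIsoOfNatIso p.isLimit (limit.isLimit (pair X₁ X₂))
      (diagramIsoPair _)
    have h2 : A.hom = e.hom.left ≫ (Over.prodLeftIsoPullback X₁ X₂).hom ≫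
        pullback.fst X₁.hom X₂.hom ≫ X₁.hom := by
      rw [Over.prodLeftIsoPullback_hom_fst_assoc, Over.w, Over.w]
    have : IsIso e.hom.left := inferInstanceAs (IsIso ((Over.forget S).map e.hom))
    change W A.hom
    rw [h2]
    exact W.comp_mem _ _ (W.of_isIso _) (W.comp_mem _ _ (W.of_isIso _)
      (W.comp_mem _ _ (W.pullback_fst _ _ (hp ⟨.right⟩)) (hp ⟨.left⟩)))
  exact ObjectProperty.IsClosedUnderFiniteProducts.mk'

variable {K : Type u} [Field K]

lemma isProper_projStr (n : ℕ) : IsProper (projStr K n) := by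
  have : IsScalarTower K (stdGrading K n 0) (MvPolynomial (Fin (n + 1)) K) :=
    IsScalarTower.of_algebraMap_eq (R := K) (S := stdGrading K n 0)
      (A := MvPolynomial (Fin (n + 1)) K) fun _ ↦ rfl
  have h1 : Algebra.FiniteType (stdGrading K n 0) (MvPolynomial (Fin (n + 1)) K) :=
    Algebra.FiniteType.of_restrictScalars_finiteType K _ _
  have h2 : Function.Surjective (algebraMap K (stdGrading K n 0)) := by
    rintro ⟨a, ha⟩
    have h3 : a.totalDegree = 0 := Nat.le_zero.1 (MvPolynomial.IsHomogeneous.totalDegree_le ha)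
    exact ⟨_, Subtype.ext (MvPolynomial.totalDegree_eq_zero_iff_eq_C.1 h3).symm⟩
  have h4 : IsClosedImmersion (Spec.map (CommRingCat.ofHom (algebraMap K (stdGrading K n 0)))) :=
    .spec_of_surjective _ h2
  infer_instance

lemma isProper_of_projective {X : Over (Spec (CommRingCat.of K))} {n : ℕ} (j : X ⟶ projSpace K n)
    [IsClosedImmersion j.left] : IsProper X.hom := by
  have h := isProper_projStr (K := K) n
  let j' : X.left ⟶ Proj (stdGrading K n) := j.left
  have hj : IsClosedImmersion j' := ‹_›
  have hj' : j' ≫ projStr K n = X.hom := Over.w j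
  rw [← hj']
  infer_instance

lemma isProper_prod {X P : Over (Spec (CommRingCat.of K))} {d : ℕ} {pr : Fin d → (P ⟶ X)}
    (hP : IsLimit (Fan.mk P pr)) (hX : IsProper X.hom) : IsProper P.hom := by
  have := isClosedUnderFiniteProducts_overObj @IsProper (Spec (CommRingCat.of K))
  exact ObjectProperty.prop_of_isLimit_fan
    (MorphismProperty.overObj @IsProper (X := Spec (CommRingCat.of K))) hP fun _ ↦ hX

end Proper

lemma isSchemeTheoreticallyDominant_toImage {X Y : Scheme.{u}} (c : X ⟶ Y) [QuasiCompact c] :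
    IsSchemeTheoreticallyDominant c.toImage := by
  rw [isSchemeTheoreticallyDominant_iff]
  refine Scheme.IdealSheafData.ext_of_iSup_eq_top
    (fun U : Y.affineOpens ↦ ⟨c.imageι ⁻¹ᵁ U.1, U.2.preimage _⟩) ?_ fun U ↦ ?_
  · rw [← Scheme.Hom.preimage_iSup, iSup_affineOpens_eq_top]
    rfl
  · rw [Scheme.Hom.ker_apply, Scheme.IdealSheafData.ideal_bot]
    exact (RingHom.injective_iff_ker_eq_bot _).1 (c.toImage_app_injective U)

/-! ### Symmetric products of projective schemes -/

section SymmetricProduct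

open PreimagesQ Limits

variable {K : Type u} [Field K] [CharZero K] {X P : Over (Spec (CommRingCat.of K))} {d m : ℕ}
  {pr : Fin d → (P ⟶ X)}

/-- The functions on a chart that are invariant under permutations come from projective space: the
chart of projective space surjects onto the ring of invariants, by `mem_adjoin_permSum`. -/
lemma GeneralCharts.exists_appLE_hom_eq (G : GeneralCharts X m d) (hP : IsLimit (Fan.mk P pr))
    (t : Fin (m + 1)) (s : Γ(P.left, prodOpen pr (G.W t)))
    (hs : ∀ σ, (prodPerm hP σ).left.appLE _ _ (prodOpen_le_preimage_prodPerm hP σ (G.W t)) s = s)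
    (hle : prodOpen pr (G.W t) ≤ (G.projCharts pr).hom ⁻¹ᵁ (G.projCharts pr).target t) :
    ∃ b, (G.projCharts pr).hom.appLE ((G.projCharts pr).target t) (prodOpen pr (G.W t)) hle b =
      s := by
  let D := G.projCharts pr
  let U := prodOpen pr (G.W t)
  let c := D.hom.appLE (D.target t) U hle
  let : Algebra K Γ(P.left, U) := (scalars P.hom U).toAlgebra
  let : Algebra K Γ(X.left, G.W t) := (scalars X.hom (G.W t)).toAlgebra
  let p (k : Fin d) : Γ(X.left, G.W t) →ₐ[K] Γ(P.left, U) :=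
    { ((pr k).left.appLE (G.W t) U (prodOpen_le pr _ k)).hom with
      commutes' := fun a ↦ by
        change (pr k).left.appLE (G.W t) U (prodOpen_le pr _ k) (scalars X.hom _ a) =
          scalars P.hom _ a
        rw [appLE_scalars]
        simp only [Over.w] }
  let ρ (σ : Equiv.Perm (Fin d)) : Γ(P.left, U) →ₐ[K] Γ(P.left, U) :=
    { ((prodPerm hP σ).left.appLE _ _ (prodOpen_le_preimage_prodPerm hP σ (G.W t))).hom with
      commutes' := fun a ↦ by
        change (prodPerm hP σ).left.appLE _ _ (prodOpen_le_preimage_prodPerm hP σ (G.W t))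
          (scalars P.hom _ a) = scalars P.hom _ a
        rw [appLE_scalars]
        simp only [Over.w] }
  let R : Subalgebra K Γ(P.left, U) :=
    { c.hom.range with
      algebraMap_mem' := fun a ↦ ⟨scalars (projStr K _) _ a, by
        change D.hom.appLE (D.target t) U hle _ = scalars P.hom _ a
        rw [appLE_scalars]
        simp only [D.hom_projStr]⟩ }
  have hy : Algebra.adjoin K (Set.range (G.y t)) = ⊤ := by
    rw [eq_top_iff]
    intro b _
    obtain ⟨q, rfl⟩ := G.surjective t b
    rw [Algebra.adjoin_range_eq_range_aeval]
    exact ⟨q, rfl⟩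
  have hR : Algebra.adjoin K (⋃ k, Set.range (p k)) = ⊤ := by
    have h := subring_prodOpen_eq_top pr hP (G.isAffineOpen_W t)
      (Algebra.adjoin K (⋃ k, Set.range (p k))).toSubring
      (fun k s ↦ Algebra.subset_adjoin (Set.mem_iUnion.2 ⟨k, s, rfl⟩))
      fun a ↦ Subalgebra.algebraMap_mem _ a
    rw [eq_top_iff]
    intro x _
    exact h.ge (Subring.mem_top x)
  have hmem := mem_adjoin_permSum p (G.y t)
    (Submodule.subset_span ⟨t, G.y_self t⟩) hy hR ρ (fun σ k b ↦ prodPerm_appLE hP σ k _ b) s hs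
  have hle : Algebra.adjoin K (Set.range (permSum p (G.y t))) ≤ R := by
    refine Algebra.adjoin_le ?_
    rintro _ ⟨I, rfl⟩
    have h1 : permSum p (G.y t) I = (d.factorial : K) • G.symFun pr t I := by
      have h2 : G.symFun pr t I = (d.factorial : K)⁻¹ • permSum p (G.y t) I :=
        (Algebra.smul_def _ _).symm
      rw [h2, smul_smul, mul_inv_cancel₀ (Nat.cast_ne_zero.2 d.factorial_ne_zero), one_smul]
    rw [h1]
    refine R.smul_mem ?_ _
    obtain ⟨b, hb⟩ := D.exists_appLE_eq t ((GeneralCharts.indexEquiv m d).symm I)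
    exact ⟨b, hb.trans (congrArg (G.symFun pr t) (Equiv.apply_symm_apply _ _))⟩
  exact hle hmem

/-- A projective scheme in characteristic zero has a projective `d`-th symmetric product, the image
of the symmetrised Segre map. -/
theorem exists_symmetricProduct {n : ℕ} (j : X ⟶ projSpace K n) [IsClosedImmersion j.left]
    (hP : IsLimit (Fan.mk P pr)) :
    ∃ (Z : Over (Spec (CommRingCat.of K))) (π : P ⟶ Z) (N : ℕ) (i : Z ⟶ projSpace K N),
      IsClosedImmersion i.left ∧ IsOrbitQuotient (fun σ ↦ (prodPerm hP σ).left) π.left := by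
  obtain ⟨G⟩ := nonempty_generalCharts j d
  let D := G.projCharts pr
  let c : P.left ⟶ Proj (stdGrading K _) := D.hom
  have hproper : IsProper P.hom := isProper_prod hP (isProper_of_projective j)
  have h1 : IsProper (c ≫ projStr K _) := by rw [D.hom_projStr]; exact hproper
  have h2 : IsProper c := .of_comp c (projStr K _)
  have hdom : IsSchemeTheoreticallyDominant c.toImage :=
    isSchemeTheoreticallyDominant_toImage c
  have hperm : ∀ σ, (prodPerm hP σ).left ≫ c.toImage = c.toImage := fun σ ↦ by
    rw [← cancel_mono c.imageι, Category.assoc, Scheme.Hom.toImage_imageι]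
    exact G.prodPerm_hom pr hP σ
  let V (t : Fin (_ + 1)) : c.image.Opens := c.imageι ⁻¹ᵁ D.target t
  have hU : ∀ t, c.toImage ⁻¹ᵁ V t = prodOpen pr (G.W t) := fun t ↦ by
    rw [← Scheme.Hom.comp_preimage, Scheme.Hom.toImage_imageι]
    exact D.preimage_target t
  have hsurj : Function.Surjective c.toImage := by
    rw [← Set.range_eq_univ, ← c.toImage.isClosedMap.isClosed_range.closure_eq,
      c.toImage.denseRange.closure_eq]
  have hq : IsOrbitQuotient (fun σ ↦ (prodPerm hP σ).left) c.toImage := by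
    refine isOrbitQuotient_of_cover _ (by rw [prodPerm_one]; rfl)
      (fun σ τ ↦ by rw [← prodPerm_comp]; rfl) _ hperm V ?_
      (fun t ↦ (D.isAffineOpen_target t).preimage _) (fun t ↦ ?_) fun t s hs ↦ ?_
    · rw [eq_top_iff]
      intro z _
      obtain ⟨x, rfl⟩ := hsurj z
      obtain ⟨t, ht⟩ := TopologicalSpace.Opens.mem_iSup.1
        (D.iSup_U.ge (TopologicalSpace.Opens.mem_top x))
      exact TopologicalSpace.Opens.mem_iSup.2 ⟨t, (hU t).ge ht⟩
    · rw [hU]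
      exact isAffineOpen_prodOpen pr hP (G.isAffineOpen_W t)
    · have hle := (hU t).ge
      obtain ⟨b, hb⟩ := G.exists_appLE_hom_eq hP t (P.left.presheaf.map (homOfLE hle).op s)
        (fun σ ↦ by
          have h3 : c.toImage ⁻¹ᵁ V t ≤ (prodPerm hP σ).left ⁻¹ᵁ (c.toImage ⁻¹ᵁ V t) := by
            rw [← Scheme.Hom.comp_preimage _ c.toImage (V t), hperm]
          rw [appLE_presheaf_map]
          conv_rhs => rw [← hs σ h3]
          rw [presheaf_map_appLE]) ((D.preimage_target t).ge)
      refine ⟨c.imageι.app (D.target t) b, ?_⟩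
      have h4 : IsIso (P.left.presheaf.map (homOfLE hle).op) := by
        have : homOfLE hle = eqToHom (hU t).symm := rfl
        rw [this]
        infer_instance
      apply (ConcreteCategory.bijective_of_isIso (P.left.presheaf.map (homOfLE hle).op)).1
      rw [← hb, Scheme.Hom.app_eq_appLE, Scheme.Hom.app_eq_appLE, appLE_appLE, presheaf_map_appLE]
      simp only [Scheme.Hom.toImage_imageι]
      rfl
  let Z : Over (Spec (CommRingCat.of K)) := Over.mk (c.imageι ≫ projStr K _)
  have hπ : c.toImage ≫ Z.hom = P.hom := by
    change c.toImage ≫ c.imageι ≫ projStr K _ = P.hom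
    rw [Scheme.Hom.toImage_imageι_assoc]
    exact D.hom_projStr
  exact ⟨Z, Over.homMk c.toImage hπ, _, Over.homMk c.imageι rfl, inferInstanceAs
    (IsClosedImmersion c.imageι), hq⟩

end SymmetricProduct

/-! ### Points and invariant closed subsets -/

section Points

/-- Some iterate of a surjective closed self-map of a noetherian space maps every irreducible
component onto itself. -/
lemma exists_iterate_image_irreducibleComponents {T : Type*} [TopologicalSpace T]
    [TopologicalSpace.NoetherianSpace T] {g : T → T} (hg : Continuous g) (hgc : IsClosedMap g)
    (hgs : Function.Surjective g) :
    ∃ k : ℕ, 0 < k ∧ ∀ C ∈ irreducibleComponents T, g^[k] '' C = C := by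
  have hfin : (irreducibleComponents T).Finite :=
    TopologicalSpace.NoetherianSpace.finite_irreducibleComponents
  -- The images of the components are finitely many closed sets that cover the space, so every
  -- component is one of them.
  have h1 : ∀ D : irreducibleComponents T, ∃ C : irreducibleComponents T, g '' C.1 = D.1 := by
    intro D
    obtain ⟨t, ht, hDt⟩ := isIrreducible_iff_sUnion_isClosed.1 D.2.1
      (hfin.image (g '' ·)).toFinset
      (fun z hz ↦ by
        rw [Set.Finite.mem_toFinset] at hz
        obtain ⟨C, hC, rfl⟩ := hz
        exact hgc _ (isClosed_of_mem_irreducibleComponents C hC))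
      (fun y _ ↦ by
        obtain ⟨x, rfl⟩ := hgs y
        rw [Set.Finite.coe_toFinset]
        exact ⟨_, ⟨_, irreducibleComponent_mem_irreducibleComponents x, rfl⟩,
          x, mem_irreducibleComponent, rfl⟩)
    rw [Set.Finite.mem_toFinset] at ht
    obtain ⟨C, hC, rfl⟩ := ht
    exact ⟨⟨C, hC⟩, (D.2.2 (hC.1.image g hg.continuousOn) hDt).antisymm hDt⟩
  choose ψ hψ using h1
  have hinj : Function.Injective ψ := fun D D' h ↦
    Subtype.ext ((hψ D).symm.trans ((congrArg (fun E ↦ g '' E.1) h).trans (hψ D')))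
  have : Finite (irreducibleComponents T) := hfin
  let e : Equiv.Perm (irreducibleComponents T) :=
    Equiv.ofBijective ψ (Finite.injective_iff_bijective.1 hinj)
  have h2 : ∀ (k : ℕ) D, g^[k] '' ((e ^ k) D).1 = D.1 := by
    intro k
    induction k with
    | zero => intro D; simp
    | succ k ih =>
      intro D
      rw [Function.iterate_succ, Set.image_comp, pow_succ', Equiv.Perm.mul_apply]
      exact (congrArg _ (hψ _)).trans (ih D)
  refine ⟨orderOf e, orderOf_pos e, fun C hC ↦ ?_⟩
  have h3 := h2 (orderOf e) ⟨C, hC⟩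
  rwa [pow_orderOf_eq_one] at h3

/-- A morphism from a reduced scheme lifts along a closed immersion as soon as it does on points. -/
lemma exists_lift_of_isClosedImmersion {V W Z : Scheme.{u}} (i : V ⟶ Z) [IsClosedImmersion i]
    [IsReduced W] (h : W ⟶ Z) (hr : Set.range h ⊆ Set.range i) : ∃ l : W ⟶ V, l ≫ i = h := by
  have hi : (i.ker.support : Set Z) = Set.range i :=
    i.support_ker.trans i.isClosedEmbedding.isClosed_range.closure_eq
  have h0 : ∀ w, h w ∈ (i.ker.support : Set Z) := fun w ↦ hi.ge (hr (Set.mem_range_self w))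
  have h1 : (i.ker.comap h).support = ⊤ := by
    rw [Scheme.IdealSheafData.support_comap, eq_top_iff]
    exact fun w _ ↦ h0 w
  have h2 : i.ker ≤ h.ker := by
    rw [← Scheme.IdealSheafData.map_bot h, Scheme.IdealSheafData.le_map_iff_comap_le]
    exact (Scheme.IdealSheafData.support_eq_top_iff.1 h1).le
  exact ⟨IsClosedImmersion.lift i h h2, IsClosedImmersion.lift_fac i h h2⟩

open PreimagesQ

variable {K : Type u} [Field K] {X : Over (Spec (CommRingCat.of K))}

/-- The underlying point of the scheme of a field-valued point. -/
noncomputable def PreimagesQ.Points.point {L : Type u} [Field L] [Algebra K L] (x : Points X L) :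
    X.left :=
  x.left (IsLocalRing.closedPoint L : Spec (CommRingCat.of L))

lemma PreimagesQ.Points.range_left {L : Type u} [Field L] [Algebra K L] (x : Points X L) :
    Set.range x.left = {x.point} := by
  have : Subsingleton (Spec (CommRingCat.of L)) :=
    inferInstanceAs (Subsingleton (PrimeSpectrum L))
  refine Set.eq_singleton_iff_unique_mem.2 ⟨⟨_, rfl⟩, ?_⟩
  rintro _ ⟨p, rfl⟩
  exact congrArg x.left (this.elim _ _)

lemma mem_pointsOf_iff {L : Type u} [Field L] [Algebra K L] {Y : X.left.IdealSheafData}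
    {x : Points X L} : x ∈ pointsOf Y L ↔ x.point ∈ Y.support := by
  have h : Set.range Y.subschemeι = Y.support := Y.range_subschemeι
  constructor
  · rintro ⟨y, hy⟩
    change _ ∈ (Y.support : Set X.left)
    rw [← h, Points.point, ← hy]
    exact ⟨_, rfl⟩
  · intro hx
    have : IsReduced (Over.mk (Spec.map (CommRingCat.ofHom (algebraMap K L)))).left :=
      inferInstanceAs (IsReduced (Spec (CommRingCat.of L)))
    refine exists_lift_of_isClosedImmersion Y.subschemeι x.left ?_
    rw [x.range_left, h, Set.singleton_subset_iff]
    exact hx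

lemma iter_left_apply (f : X ⟶ X) (n : ℕ) (x : X.left) : (iter f n).left x = f.left^[n] x := by
  induction n with
  | zero => rfl
  | succ n ih =>
    rw [Function.iterate_succ_apply', ← ih]
    rfl

lemma mem_pointsOf_preimage_iff {L : Type u} [Field L] [Algebra K L] {Y : X.left.IdealSheafData}
    {f : X ⟶ X} {n : ℕ} {x : Points X L} :
    x ∈ pointsOf (preimage f Y n) L ↔ f.left^[n] x.point ∈ Y.support := by
  rw [mem_pointsOf_iff, Scheme.IdealSheafData.support_comap, ← iter_left_apply]
  rfl

lemma PreimagesQ.IsInvariant.mapsTo {f : X ⟶ X} {Y : X.left.IdealSheafData}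
    (h : IsInvariant f Y) : Set.MapsTo f.left Y.support Y.support := by
  obtain ⟨g, hg⟩ := h
  have hr : Set.range Y.subschemeι = Y.support := Y.range_subschemeι
  rw [← hr]
  rintro _ ⟨y, rfl⟩
  exact ⟨g y, congr($hg y)⟩

lemma isInvariant_vanishingIdeal {f : X ⟶ X} {T : TopologicalSpace.Closeds X.left}
    (h : Set.MapsTo f.left T T) :
    IsInvariant f (Scheme.IdealSheafData.vanishingIdeal T) := by
  let I := Scheme.IdealSheafData.vanishingIdeal T
  have h1 : I.subschemeι.ker ≤ (I.subschemeι ≫ f.left).ker := by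
    rw [← Scheme.IdealSheafData.map_ker, Scheme.IdealSheafData.ker_subschemeι,
      Scheme.IdealSheafData.map_vanishingIdeal]
    exact Scheme.IdealSheafData.vanishingIdeal_antimono
      (TopologicalSpace.Closeds.closure_le.2 h.image_subset)
  exact ⟨IsClosedImmersion.lift _ _ h1, IsClosedImmersion.lift_fac _ _ h1⟩

/-- The `L`-points whose orbits meet `T` enter it within a number of steps independent of the point.
For a forward invariant set `T` it suffices to record the position after that many steps. -/
def BoundedEntry (L : Type u) [Field L] [Algebra K L] (f : X ⟶ X) (T : Set X.left) : Prop :=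
  ∃ s₀ : ℕ, ∀ x : Points X L, (∃ n, f.left^[n] x.point ∈ T) → f.left^[s₀] x.point ∈ T

lemma iterate_mem_of_le {T : Type*} {g : T → T} {s : Set T} (h : Set.MapsTo g s s) {m n : ℕ}
    (hmn : m ≤ n) {x : T} (hx : g^[m] x ∈ s) : g^[n] x ∈ s := by
  rw [← Nat.sub_add_cancel hmn, Function.iterate_add_apply]
  exact h.iterate _ hx

lemma newPoints_eq_empty {L : Type u} [Field L] [Algebra K L] {f : X ⟶ X}
    {Y : X.left.IdealSheafData} (hY : IsInvariant f Y) {s₀ : ℕ}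
    (h : ∀ x : Points X L, (∃ n, f.left^[n] x.point ∈ Y.support) →
      f.left^[s₀] x.point ∈ Y.support) {s : ℕ} (hs : s₀ ≤ s) : newPoints f Y s L = ∅ := by
  rw [Set.eq_empty_iff_forall_notMem]
  rintro x ⟨hx, hx'⟩
  rw [mem_pointsOf_preimage_iff] at hx hx'
  exact hx' (iterate_mem_of_le hY.mapsTo hs (h x ⟨_, hx⟩))

lemma PreimagesQ.PIQ.boundedEntry {f : X ⟶ X} {Y : X.left.IdealSheafData} (hY : IsInvariant f Y)
    (h : PIQ K X f Y) : BoundedEntry K f (Y.support : Set X.left) := by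
  obtain ⟨s₀, hs₀⟩ := h
  refine ⟨s₀, fun x ⟨n, hn⟩ ↦ ?_⟩
  have h1 : ∀ m, f.left^[s₀ + m] x.point ∈ (Y.support : Set X.left) →
      f.left^[s₀] x.point ∈ (Y.support : Set X.left) := by
    intro m
    induction m with
    | zero => exact id
    | succ m ih =>
      refine fun hm ↦ ih (by_contra fun hm' ↦ ?_)
      exact Set.eq_empty_iff_forall_notMem.1 (hs₀ (s₀ + m) (Nat.le_add_right _ _)) x
        ⟨mem_pointsOf_preimage_iff.2 hm, fun h ↦ hm' (mem_pointsOf_preimage_iff.1 h)⟩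
  exact h1 n (iterate_mem_of_le hY.mapsTo (Nat.le_add_left _ _) hn)

/-- The assertion about rational points, for integral projective schemes, implies the same
assertion for all projective schemes. -/
lemma boundedEntry_of_projective
    (H : ∀ (X : Over (Spec (CommRingCat.of K))) (f : X ⟶ X) (Y : X.left.IdealSheafData),
      IsProjectiveVariety X → Surjective f.left → IsInvariant f Y → PIQ K X f Y)
    {Z : Over (Spec (CommRingCat.of K))} {N : ℕ} (i : Z ⟶ projSpace K N)
    [IsClosedImmersion i.left] (g : Z ⟶ Z) (hg : Surjective g.left) {T : Set Z.left}
    (hTc : IsClosed T) (hT : Set.MapsTo g.left T T) : BoundedEntry K g T := by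
  have hZ : IsProper Z.hom := isProper_of_projective i
  have : IsLocallyNoetherian Z.left := LocallyOfFiniteType.isLocallyNoetherian Z.hom
  have : CompactSpace Z.left := QuasiCompact.compactSpace_of_compactSpace Z.hom
  have : IsNoetherian Z.left := {}
  have hgp : IsProper g.left := by
    have : IsProper (g.left ≫ Z.hom) := by rw [Over.w]; exact hZ
    exact .of_comp g.left Z.hom
  obtain ⟨k, hk, hC⟩ := exists_iterate_image_irreducibleComponents g.left.continuous
    g.left.isClosedMap g.left.surjective
  have hcomp : ∀ C ∈ irreducibleComponents Z.left, ∃ s, ∀ x : Points Z K, x.point ∈ C →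
      (∃ n, g.left^[n] x.point ∈ T) → g.left^[k * s] x.point ∈ T := by
    intro C hCmem
    obtain ⟨η, hη⟩ := QuasiSober.sober hCmem.1 (isClosed_of_mem_irreducibleComponents C hCmem)
    -- The component with its reduced structure is the image of its generic point.
    let c := Z.left.fromSpecResidueField η
    have hdom := isSchemeTheoreticallyDominant_toImage c
    have : IsReduced c.image := IsSchemeTheoreticallyDominant.isReduced c.toImage
    have : IrreducibleSpace c.image := by
      have h1 : IsIrreducible (Set.range c.toImage) := by
        rw [← Set.image_univ]
        exact (IrreducibleSpace.isIrreducible_univ _).image _ c.toImage.continuous.continuousOn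
      have h2 := h1.closure
      rw [c.toImage.denseRange.closure_eq] at h2
      exact (irreducibleSpace_def _).2 h2
    have hint : IsIntegral c.image := isIntegral_of_irreducibleSpace_of_isReduced _
    have hrange : Set.range c.imageι = C := by
      have h1 : Set.range c.imageι = c.ker.support := c.ker.range_subschemeι
      rw [h1, Scheme.Hom.support_ker, Scheme.range_fromSpecResidueField]
      exact hη
    let XC : Over (Spec (CommRingCat.of K)) := Over.mk (c.imageι ≫ Z.hom)
    let ιC : XC ⟶ Z := Over.homMk c.imageι rfl
    have hιC : IsClosedImmersion ιC.left := inferInstanceAs (IsClosedImmersion c.imageι)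
    have : IsReduced XC.left := ‹IsReduced c.image›
    have hvar : IsProjectiveVariety XC := ⟨hint, N, ιC ≫ i, by
      rw [Over.comp_left]
      infer_instance⟩
    obtain ⟨l, hl⟩ := exists_lift_of_isClosedImmersion ιC.left (ιC ≫ iter g k).left (by
      rintro _ ⟨y, rfl⟩
      refine hrange.ge ?_
      rw [← hC C hCmem]
      exact ⟨ιC.left y, hrange.le ⟨y, rfl⟩, (iter_left_apply g k _).symm⟩)
    let f : XC ⟶ XC := Over.homMk l (by
      rw [← Over.w ιC, reassoc_of% hl, Over.w, Over.w])
    have hfι : ∀ y, ιC.left (f.left y) = g.left^[k] (ιC.left y) := fun y ↦ by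
      rw [← iter_left_apply]
      exact congr($hl y)
    have hfn : ∀ n y, ιC.left (f.left^[n] y) = g.left^[k * n] (ιC.left y) := by
      intro n y
      induction n with
      | zero => rfl
      | succ n ih =>
        rw [Function.iterate_succ_apply', hfι, ih, ← Function.iterate_add_apply, mul_add, mul_one,
          add_comm]
    have hinj : Function.Injective ιC.left := ιC.left.isClosedEmbedding.injective
    have hsurj : Surjective f.left := ⟨fun y ↦ by
      have h1 : ιC.left y ∈ g.left^[k] '' C := by
        rw [hC C hCmem]
        exact hrange.le ⟨y, rfl⟩
      obtain ⟨z, hz, hzy⟩ := h1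
      obtain ⟨w, rfl⟩ := hrange.ge hz
      exact ⟨w, hinj ((hfι w).trans hzy)⟩⟩
    let TC : TopologicalSpace.Closeds XC.left := ⟨ιC.left ⁻¹' T, hTc.preimage ιC.left.continuous⟩
    have hTC : Set.MapsTo f.left TC TC := fun y hy ↦ by
      change ιC.left (f.left y) ∈ T
      rw [hfι]
      exact hT.iterate k hy
    have hinv := isInvariant_vanishingIdeal hTC
    obtain ⟨s, hs⟩ := (H XC f _ hvar hsurj hinv).boundedEntry hinv
    rw [Scheme.IdealSheafData.coe_support_vanishingIdeal] at hs
    refine ⟨s, fun x hxC ⟨n, hn⟩ ↦ ?_⟩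
    have : IsReduced (Over.mk (Spec.map (CommRingCat.ofHom (algebraMap K K)))).left :=
      inferInstanceAs (IsReduced (Spec (CommRingCat.of K)))
    obtain ⟨y, hy⟩ := exists_lift_of_isClosedImmersion ιC.left x.left (by
      rw [x.range_left, Set.singleton_subset_iff]
      exact hrange.ge hxC)
    let y' : Points XC K := Over.homMk y (by rw [← Over.w ιC, reassoc_of% hy, Over.w])
    have hy' : ιC.left y'.point = x.point := congr($hy _)
    have h1 := hs y' ⟨n, by
      change ιC.left _ ∈ T
      rw [hfn, hy']
      exact iterate_mem_of_le hT (Nat.le_mul_of_pos_left n hk) hn⟩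
    change ιC.left _ ∈ T at h1
    rwa [hfn, hy'] at h1
  choose! s hs using hcomp
  have hfin : (irreducibleComponents Z.left).Finite :=
    TopologicalSpace.NoetherianSpace.finite_irreducibleComponents
  refine ⟨k * hfin.toFinset.sup s, fun x hx ↦ ?_⟩
  have hmem := irreducibleComponent_mem_irreducibleComponents x.point
  exact iterate_mem_of_le hT
    (Nat.mul_le_mul_left k (Finset.le_sup (f := s) (hfin.mem_toFinset.2 hmem)))
    (hs _ hmem x mem_irreducibleComponent hx)

end Points

/-! ### Galois descent for points -/

section Descent

open PreimagesQ Limits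

variable {K : Type u} [Field K]

/-- The morphism of spectra over `K` induced by a homomorphism of field extensions of `K`. -/
noncomputable def specAlgHom {L M : Type u} [Field L] [Algebra K L] [Field M] [Algebra K M]
    (φ : L →ₐ[K] M) : Over.mk (Spec.map (CommRingCat.ofHom (algebraMap K M))) ⟶
      Over.mk (Spec.map (CommRingCat.ofHom (algebraMap K L))) :=
  Over.homMk (Spec.map (CommRingCat.ofHom φ.toRingHom)) (by
    change Spec.map _ ≫ Spec.map _ = Spec.map _
    rw [← Spec.map_comp, ← CommRingCat.ofHom_comp]
    exact congrArg (fun r ↦ Spec.map (CommRingCat.ofHom r)) φ.comp_algebraMap)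

lemma specAlgHom_comp {L M N : Type u} [Field L] [Algebra K L] [Field M] [Algebra K M] [Field N]
    [Algebra K N] (φ : L →ₐ[K] M) (ψ : M →ₐ[K] N) :
    specAlgHom ψ ≫ specAlgHom φ = specAlgHom (ψ.comp φ) := by
  ext1
  change Spec.map _ ≫ Spec.map _ = Spec.map _
  rw [← Spec.map_comp]
  rfl

lemma point_specAlgHom_comp {X : Over (Spec (CommRingCat.of K))} {L M : Type u} [Field L]
    [Algebra K L] [Field M] [Algebra K M] (φ : L →ₐ[K] M) (x : Points X L) :
    Points.point (specAlgHom φ ≫ x : Points X M) = x.point := by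
  have h : Subsingleton (Spec (CommRingCat.of L)) :=
    inferInstanceAs (Subsingleton (PrimeSpectrum L))
  exact congrArg x.left (h.elim _ _)

/-- A point over a Galois extension that is fixed by the Galois group has the same underlying
point of the scheme as a rational point. -/
lemma exists_point_eq_of_specAlgHom_comp_eq {Z : Over (Spec (CommRingCat.of K))} {Ω : Type u}
    [Field Ω] [Algebra K Ω] [IsGalois K Ω] (z : Points Z Ω)
    (hz : ∀ τ : Gal(Ω/K), specAlgHom (τ : Ω →ₐ[K] Ω) ≫ z = z) :
    ∃ y : Points Z K, y.point = z.point := by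
  let zl : Spec (CommRingCat.of Ω) ⟶ Z.left := z.left
  obtain ⟨⟨p, φ⟩, hφ⟩ := (Scheme.SpecToEquivOfField Ω Z.left).symm.surjective zl
  replace hφ : Spec.map φ ≫ Z.left.fromSpecResidueField p = zl := hφ
  have h1 : ∀ τ : Gal(Ω/K), φ ≫ CommRingCat.ofHom (τ : Ω →ₐ[K] Ω).toRingHom = φ := fun τ ↦ by
    refine Spec.map_injective ?_
    rw [← cancel_mono (Z.left.fromSpecResidueField p), Spec.map_comp, Category.assoc, hφ]
    exact congrArg Over.Hom.left (hz τ)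
  have h2 : ∀ a, φ.hom a ∈ (algebraMap K Ω).range := fun a ↦
    (InfiniteGalois.mem_range_algebraMap_iff_fixed _).2 fun τ ↦ congr($(h1 τ) a)
  let e : K ≃+* (algebraMap K Ω).range := RingEquiv.ofBijective (algebraMap K Ω).rangeRestrict
    ⟨fun a b h ↦ (algebraMap K Ω).injective (congrArg Subtype.val h),
      (algebraMap K Ω).rangeRestrict_surjective⟩
  let ψ : Z.left.residueField p →+* K :=
    (e.symm : (algebraMap K Ω).range →+* K).comp (φ.hom.codRestrict _ h2)
  have hψ : CommRingCat.ofHom ψ ≫ CommRingCat.ofHom (algebraMap K Ω) = φ := by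
    ext a
    exact congrArg Subtype.val (e.apply_symm_apply ⟨φ.hom a, h2 a⟩)
  let y : Spec (CommRingCat.of K) ⟶ Z.left :=
    Spec.map (CommRingCat.ofHom ψ) ≫ Z.left.fromSpecResidueField p
  have hy : Spec.map (CommRingCat.ofHom (algebraMap K Ω)) ≫ y = zl := by
    rw [← hφ, ← hψ, Spec.map_comp, Category.assoc]
  obtain ⟨θ, hθ⟩ := Spec.map_surjective (y ≫ Z.hom)
  have h3 : θ ≫ CommRingCat.ofHom (algebraMap K Ω) = CommRingCat.ofHom (algebraMap K Ω) := by
    refine Spec.map_injective ?_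
    rw [Spec.map_comp, hθ, reassoc_of% hy]
    exact Over.w z
  have h4 : θ = CommRingCat.ofHom (algebraMap K K) := by
    ext a
    exact (algebraMap K Ω).injective congr($h3 a)
  refine ⟨Over.homMk y (hθ.symm.trans (congrArg Spec.map h4)), ?_⟩
  have h : Subsingleton (Spec (CommRingCat.of K)) :=
    inferInstanceAs (Subsingleton (PrimeSpectrum K))
  have h5 : z.point = y (Spec.map (CommRingCat.ofHom (algebraMap K Ω))
      (IsLocalRing.closedPoint Ω : Spec (CommRingCat.of Ω))) := congr($hy.symm _)
  rw [h5]
  exact congrArg y (h.elim _ _)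

/-- The conjugates of a point over an extension of degree `d` form a point of the `d`-fold product
which Galois automorphisms move by permutations of the coordinates. -/
lemma exists_conjugates {X P : Over (Spec (CommRingCat.of K))} {d : ℕ} {pr : Fin d → (P ⟶ X)}
    (hP : IsLimit (Fan.mk P pr)) (Ω : Type u) [Field Ω] [IsAlgClosed Ω] [Algebra K Ω] {L : Type u}
    [Field L] [Algebra K L] [FiniteDimensional K L] [Algebra.IsSeparable K L]
    (hd : Module.finrank K L = d) (x : Points X L) :
    ∃ q : Points P Ω, (∀ k, (pr k).left q.point = x.point) ∧
      ∀ τ : Gal(Ω/K), ∃ σ, specAlgHom (τ : Ω →ₐ[K] Ω) ≫ q = q ≫ prodPerm hP σ := by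
  let ε : Fin d ≃ (L →ₐ[K] Ω) :=
    (Fintype.equivFinOfCardEq ((AlgHom.card K L Ω).trans hd)).symm
  let q : Points P Ω := Fan.IsLimit.lift hP fun k ↦ specAlgHom (ε k) ≫ x
  have hq : ∀ k, q ≫ pr k = specAlgHom (ε k) ≫ x := fun k ↦
    Fan.IsLimit.fac hP (fun k ↦ specAlgHom (ε k) ≫ x) k
  refine ⟨q, fun k ↦ ?_, fun τ ↦ ?_⟩
  · rw [← point_specAlgHom_comp (ε k) x, ← hq]
    rfl
  · refine ⟨(ε.trans (AlgEquiv.arrowCongr .refl τ)).trans ε.symm, ?_⟩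
    refine Fan.IsLimit.hom_ext hP _ _ fun k ↦ ?_
    change (_ ≫ q) ≫ pr k = (q ≫ _) ≫ pr k
    rw [Category.assoc, Category.assoc, prodPerm_pr, hq, hq, ← Category.assoc, specAlgHom_comp]
    simp only [Equiv.trans_apply, Equiv.apply_symm_apply]
    rfl

end Descent

/-! ### Self-maps of products -/

section SelfMaps

open Limits

variable {K : Type u} [Field K] {X P : Over (Spec (CommRingCat.of K))} {d : ℕ}
  {pr : Fin d → (P ⟶ X)}

/-- Applying a surjective morphism to some of the coordinates of a product is surjective: for a
single coordinate this is a base change of the given morphism. -/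
lemma surjective_of_comp_pr_eq_ite (hP : IsLimit (Fan.mk P pr)) (f : X ⟶ X)
    (hf : Surjective f.left) (s : Finset (Fin d)) (F : P ⟶ P)
    (hF : ∀ k, F ≫ pr k = if k ∈ s then pr k ≫ f else pr k) : Surjective F.left := by
  induction s using Finset.induction generalizing F with
  | empty =>
    have h : F = 𝟙 P := Fan.IsLimit.hom_ext hP _ _ fun k ↦ (hF k).trans (Category.id_comp _).symm
    rw [h]
    exact inferInstanceAs (Surjective (𝟙 P.left))
  | insert a s ha ih =>
    let F₁ : P ⟶ P := Fan.IsLimit.lift hP fun k ↦ if k ∈ s then pr k ≫ f else pr k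
    have hF₁ : ∀ k, F₁ ≫ pr k = if k ∈ s then pr k ≫ f else pr k := Fan.IsLimit.fac hP _
    let F₂ : P ⟶ P := Fan.IsLimit.lift hP fun k ↦ if k = a then pr k ≫ f else pr k
    have hF₂ : ∀ k, F₂ ≫ pr k = if k = a then pr k ≫ f else pr k := Fan.IsLimit.fac hP _
    have h1 : Surjective F₁.left := ih F₁ hF₁
    have h2 : F = F₁ ≫ F₂ := by
      refine Fan.IsLimit.hom_ext hP _ _ fun k ↦ ?_
      change F ≫ pr k = (F₁ ≫ F₂) ≫ pr k
      rw [hF, Category.assoc, hF₂]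
      by_cases hk : k = a
      · subst hk
        rw [if_pos (Finset.mem_insert_self _ _), if_pos rfl, ← Category.assoc, hF₁, if_neg ha]
      · simp only [Finset.mem_insert, hk, false_or, if_false, hF₁]
    have hw : pr a ≫ f = F₂ ≫ pr a := by rw [hF₂, if_pos rfl]
    have h3 : IsPullback (pr a) F₂ f (pr a) := by
      refine ⟨⟨hw⟩, ⟨PullbackCone.IsLimit.mk hw
        (fun c ↦ Fan.IsLimit.lift hP fun k ↦ if k = a then c.fst else c.snd ≫ pr k)
        (fun c ↦ ?_) (fun c ↦ ?_) fun c m hm hm' ↦ ?_⟩⟩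
      · exact (Fan.IsLimit.fac hP _ a).trans (if_pos rfl)
      · refine Fan.IsLimit.hom_ext hP _ _ fun k ↦ ?_
        change (Fan.IsLimit.lift hP _ ≫ F₂) ≫ pr k = c.snd ≫ pr k
        rw [Category.assoc, hF₂]
        split_ifs with hk
        · subst hk
          rw [← c.condition, ← Category.assoc]
          exact congrArg (· ≫ f) ((Fan.IsLimit.fac hP _ k).trans (if_pos rfl))
        · exact (Fan.IsLimit.fac hP _ k).trans (if_neg hk)
      · refine Fan.IsLimit.hom_ext hP _ _ fun k ↦ ?_
        refine Eq.trans ?_ (Fan.IsLimit.fac hP _ k).symm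
        change m ≫ pr k = _
        split_ifs with hk
        · subst hk
          exact hm
        · rw [← hm', Category.assoc, hF₂, if_neg hk]
    have h4 : Surjective F₂.left :=
      MorphismProperty.of_isPullback (P := @Surjective) (h3.map (Over.forget _)) hf
    rw [h2, Over.comp_left]
    infer_instance

end SelfMaps

/-! ### Points of bounded degree -/

section BoundedDegree

open PreimagesQ Limits

variable {K : Type u} [Field K] [CharZero K]

/-- For points over extensions of a fixed degree `d`, the symmetric product and the conjugates of
the point reduce the assertion to rational points. -/
lemma exists_bound_of_finrank_eq
    (H : ∀ (X : Over (Spec (CommRingCat.of K))) (f : X ⟶ X) (Y : X.left.IdealSheafData),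
      IsProjectiveVariety X → Surjective f.left → IsInvariant f Y → PIQ K X f Y)
    {X : Over (Spec (CommRingCat.of K))} {n : ℕ} (j : X ⟶ projSpace K n)
    [IsClosedImmersion j.left] (f : X ⟶ X) (hf : Surjective f.left) {T : Set X.left}
    (hTc : IsClosed T) (hT : Set.MapsTo f.left T T) {d : ℕ} (hd : 0 < d) :
    ∃ s₀ : ℕ, ∀ (L : Type u) [Field L] [Algebra K L], FiniteDimensional K L →
      Module.finrank K L = d → ∀ x : Points X L,
        (∃ n, f.left^[n] x.point ∈ T) → f.left^[s₀] x.point ∈ T := by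
  let P : Over (Spec (CommRingCat.of K)) := ∏ᶜ fun _ : Fin d ↦ X
  let pr : Fin d → (P ⟶ X) := Pi.π fun _ : Fin d ↦ X
  have hP : IsLimit (Fan.mk P pr) := productIsProduct _
  obtain ⟨Z, π, N, i, hi, hπ⟩ := exists_symmetricProduct j hP
  have := hπ.surjective
  have := hπ.dominant
  have := hπ.isIntegralHom
  -- The induced self-maps of the product and of the symmetric product.
  let F : P ⟶ P := Fan.IsLimit.lift hP fun k ↦ pr k ≫ f
  have hF : ∀ k, F ≫ pr k = pr k ≫ f := Fan.IsLimit.fac hP _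
  have hFs : Surjective F.left := surjective_of_comp_pr_eq_ite hP f hf Finset.univ F fun k ↦ by
    rw [hF, if_pos (Finset.mem_univ k)]
  have hFσ : ∀ σ, prodPerm hP σ ≫ F = F ≫ prodPerm hP σ := fun σ ↦ by
    refine Fan.IsLimit.hom_ext hP _ _ fun k ↦ ?_
    change (prodPerm hP σ ≫ F) ≫ pr k = (F ≫ prodPerm hP σ) ≫ pr k
    rw [Category.assoc, Category.assoc, hF, prodPerm_pr, hF, ← Category.assoc, prodPerm_pr]
  obtain ⟨gl, hgl⟩ := hπ.exists_desc (F.left ≫ π.left) fun σ ↦ by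
    rw [← Category.assoc, ← Over.comp_left, hFσ, Over.comp_left, Category.assoc, hπ.comp]
  let g : Z ⟶ Z := Over.homMk gl (eq_of_comp_eq_of_surjective π.left (by
    rw [reassoc_of% hgl, Over.w, Over.w]))
  have hgπ : ∀ p, g.left (π.left p) = π.left (F.left p) := fun p ↦ congr($hgl p)
  have hgs : Surjective g.left := ⟨fun z ↦ by
    obtain ⟨p, rfl⟩ := π.left.surjective z
    obtain ⟨p, rfl⟩ := F.left.surjective p
    exact ⟨π.left p, hgπ p⟩⟩
  have hgn : ∀ m p, g.left^[m] (π.left p) = π.left (F.left^[m] p) := fun m p ↦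
    ((Function.Semiconj.iterate_right (f := π.left) (fun p ↦ (hgπ p).symm) m) p).symm
  have hFn : ∀ m k p, (pr k).left (F.left^[m] p) = f.left^[m] ((pr k).left p) := fun m k p ↦
    (Function.Semiconj.iterate_right (f := (pr k).left) (ga := F.left) (gb := f.left)
      (fun p ↦ congr(($(hF k)).left p)) m) p
  -- The points of the product all of whose coordinates are in `T`.
  let TP : Set P.left := ⋂ k, (pr k).left ⁻¹' T
  have hTPc : IsClosed TP := isClosed_iInter fun k ↦ hTc.preimage (pr k).left.continuous
  have hTP : Set.MapsTo F.left TP TP := fun p hp ↦ Set.mem_iInter.2 fun k ↦ by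
    change (pr k).left (F.left p) ∈ T
    rw [show (pr k).left (F.left p) = f.left ((pr k).left p) from hFn 1 k p]
    exact hT (Set.mem_iInter.1 hp k)
  have hTPπ : ∀ p, π.left p ∈ π.left '' TP ↔ p ∈ TP := fun p ↦ by
    refine ⟨fun ⟨p', hp', h⟩ ↦ ?_, fun hp ↦ ⟨p, hp, rfl⟩⟩
    obtain ⟨σ, rfl⟩ := hπ.exists_act p' p h
    refine Set.mem_iInter.2 fun k ↦ ?_
    change (pr k).left ((prodPerm hP σ).left p') ∈ T
    rw [← Scheme.Hom.comp_apply, prodPerm_left_pr]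
    exact Set.mem_iInter.1 hp' (σ k)
  have hTZ : Set.MapsTo g.left (π.left '' TP) (π.left '' TP) := by
    rintro _ ⟨p, hp, rfl⟩
    rw [hgπ]
    exact ⟨_, hTP hp, rfl⟩
  obtain ⟨s₀, hs₀⟩ := boundedEntry_of_projective H i g hgs (π.left.isClosedMap _ hTPc) hTZ
  refine ⟨s₀, fun L _ _ hL hLd x hx ↦ ?_⟩
  obtain ⟨q, hqx, hq⟩ := exists_conjugates hP (AlgebraicClosure K) hLd x
  obtain ⟨y, hy⟩ := exists_point_eq_of_specAlgHom_comp_eq (q ≫ π : Points Z (AlgebraicClosure K))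
    fun τ ↦ by
      obtain ⟨σ, hσ⟩ := hq τ
      have h1 : prodPerm hP σ ≫ π = π := by
        ext1
        exact hπ.comp σ
      rw [← Category.assoc, hσ, Category.assoc, h1]
  -- The orbit of `y` meets the image of `TP` when the orbit of `x` meets `T`.
  have key : ∀ m, g.left^[m] y.point ∈ π.left '' TP ↔ f.left^[m] x.point ∈ T := fun m ↦ by
    have h1 : y.point = π.left q.point := hy
    rw [h1, hgn, hTPπ, Set.mem_iInter]
    refine ⟨fun h ↦ ?_, fun h k ↦ ?_⟩
    · have h2 : (pr ⟨0, hd⟩).left _ ∈ T := h ⟨0, hd⟩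
      rwa [hFn, hqx] at h2
    · change (pr k).left _ ∈ T
      rwa [hFn, hqx]
  exact (key s₀).1 (hs₀ y (hx.imp fun m ↦ (key m).2))

end BoundedDegree

theorem mainTheorem6 :
    (∀ (K : Type u) [Field K] [NumberField K] (X : Over (Spec (CommRingCat.of K)))
        (f : X ⟶ X) (Y : X.left.IdealSheafData),
        PreimagesQ.IsProjectiveVariety X → Surjective f.left → PreimagesQ.IsInvariant f Y →
          PreimagesQ.PIQ K X f Y) ↔
      (∀ (K : Type u) [Field K] [NumberField K] (X : Over (Spec (CommRingCat.of K)))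
        (f : X ⟶ X) (Y : X.left.IdealSheafData) (d : ℕ),
        PreimagesQ.IsProjectiveVariety X → Surjective f.left → PreimagesQ.IsInvariant f Y →
          PreimagesQ.PIQBoundedDegree K X f Y d) := by
  constructor
  · intro H K _ _ X f Y d hX hf hY
    obtain ⟨n, j, hj⟩ := hX.projective
    have h1 : ∀ e, 0 < e → ∃ s₀ : ℕ, ∀ (L : Type u) [Field L] [Algebra K L],
        FiniteDimensional K L → Module.finrank K L = e → ∀ x : PreimagesQ.Points X L,
          (∃ n, f.left^[n] x.point ∈ (Y.support : Set X.left)) →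
            f.left^[s₀] x.point ∈ (Y.support : Set X.left) := fun e he ↦
      exists_bound_of_finrank_eq (H K) j f hf Y.support.isClosed hY.mapsTo he
    choose! s hs using h1
    refine ⟨(Finset.range (d + 1)).sup s, fun t ht L _ _ hL hLd ↦ ?_⟩
    have h2 : s (Module.finrank K L) ≤ t :=
      (Finset.le_sup (Finset.mem_range.2 (Nat.lt_succ_of_le hLd))).trans ht
    exact newPoints_eq_empty hY (hs _ Module.finrank_pos L hL rfl) h2
  · intro H K _ _ X f Y hX hf hY
    obtain ⟨s₀, hs₀⟩ := H K X f Y 1 hX hf hY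
    exact ⟨s₀, fun s hs ↦ hs₀ s hs K inferInstance (Module.finrank_self K).le⟩
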